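/- Let $G$ be a finite abelian $p$-group ($p$ prime). The power graph $\mathcal P(G)$ has the nontrivial elements of $G$ as vertices, two distinct ones being adjacent if one is a power of the other; $N(x)$ denotes the open neighbourhood of $x$ in $\mathcal P(G)$. For a finite graph $\Gamma$ let $\overline{\Gamma}$ be the weighted graph whose vertices are the classes $\bar v$ of vertices of $\Gamma$ with the same closed neighbourhood in $\Gamma$, the weight of a class being its cardinality, where two distinct classes are adjacent if they have adjacent representatives; automorphisms of $\overline{\Gamma}$ are required to preserve weights. For $1\neq x\in G$ let $\widehat{x}=\overline{\Gamma_x}$, where $\Gamma_x$ is the subgraph of $\mathcal P(G)$ induced on $N(x)\setminus\langle x\rangle$. The height of a nontrivial element $x$ of a finite abelian $p$-group $A$ is the largest power $p^n$ with $x\in A^{p^n}$. Put $\Omega_n(A)=\{x\in A: x^{p^n}=1\}$ and, for $n\ge 1$, $H_n(A)=\{x\in A: o(x)=p,\ x\text{ has height }p^{n-1}\text{ in }A\}$. For a group $A$, $A\wr S_k=A^k\rtimes S_k$ with $S_k$ permuting the $k$ factors. **Corollary 4.7.** Let $b\in G$ be a nontrivial element of height $p^t$ with $t\ge 1$. Then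 there are an element $a\in G$ with $a^{p^t}=b$, a subgroup $L$ with $\langle N(b)\rangle=L\times\langle a\rangle$, an integer $m\ge1$, and subgroups $L_1,\dots,L_m$ with $L=L_1\times\cdots\times L_m$, such that $L_i\cong(\mathbb Z_{p^{e_i}})^{r_i}$ for all $i$, where $1\le e_1<\dots<e_{m-1}<e_m=t$, $r_i\ge 1$ for $i<m$, and $r_m\ge 0$ (so that $L_m$ may be trivial); moreover there are elements $x_i\in H_{e_i}(\Omega_{t+1}(L))$ for $1\le i<m$, and an element $c\in\langle a\rangle$ of order $p\cdot o(b)$. For every choice of all these data, $$\mathrm{Aut}(\widehat b)\;\cong\;\bigl(\mathrm{Aut}(\widehat{(x_1,c)})\wr S_{k_1}\bigr)\times\cdots\times\bigl(\mathrm{Aut}(\widehat{(x_{m-1},c)})\wr S_{k_{m-1}}\bigr)\times\bigl(\mathrm{Aut}(\widehat c)\wr S_{k_m}\bigr),$$ where $(x_i,c)=x_ic\in L\times\langle a\rangle$, $k_i=|H_{e_i}(\Omega_{t+1}(L))|$ for $1\le i<m$, and $k_m=p^{r}$ with $r=r_m$, the number of cyclic direct factors of $L_m$. -/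

import Mathlib

namespace PowerGraphAut

/-- The power graph of a group: the vertices are the nontrivial elements, and two distinct
vertices are adjacent if one of them is a power of the other (with a positive exponent). -/
def powerGraph (G : Type*) [Group G] : SimpleGraph {g : G // g ≠ 1} where
  Adj x y := x ≠ y ∧
    ((∃ m : ℕ, 0 < m ∧ (y : G) = (x : G) ^ m) ∨ (∃ m : ℕ, 0 < m ∧ (x : G) = (y : G) ^ m))
  symm := ⟨fun _ _ h => ⟨h.1.symm, h.2.symm⟩⟩
  loopless := ⟨fun _ h => h.1 rfl⟩

/-- The closed neighbourhood `N[v]`. -/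
def closedNbhd {V : Type*} (Γ : SimpleGraph V) (v : V) : Set V :=
  insert v (Γ.neighborSet v)

/-- Two vertices are identified if they have the same closed neighbourhood; the classes are
exactly the (nonempty) maximal sets of vertices with equal closed neighbourhoods. -/
def menSetoid {V : Type*} (Γ : SimpleGraph V) : Setoid V where
  r u v := closedNbhd Γ u = closedNbhd Γ v
  iseqv := ⟨fun _ => rfl, fun h => h.symm, fun h₁ h₂ => h₁.trans h₂⟩

/-- The underlying graph of the weighted quotient graph `Γ̄`: distinct classes are adjacent if
they have adjacent representatives. -/
def menQuotient {V : Type*} (Γ : SimpleGraph V) : SimpleGraph (Quotient (menSetoid Γ)) where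
  Adj A B := A ≠ B ∧
    ∃ x y : V, Quotient.mk (menSetoid Γ) x = A ∧ Quotient.mk (menSetoid Γ) y = B ∧ Γ.Adj x y
  symm := ⟨fun _ _ h => by
    obtain ⟨hne, x, y, hx, hy, hxy⟩ := h
    exact ⟨hne.symm, y, x, hy, hx, hxy.symm⟩⟩
  loopless := ⟨fun _ h => h.1 rfl⟩

/-- The weight of a class: its number of elements. -/
noncomputable def menWeight {V : Type*} (Γ : SimpleGraph V) (A : Quotient (menSetoid Γ)) : ℕ :=
  Nat.card {x : V // Quotient.mk (menSetoid Γ) x = A}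

/-- The group of automorphisms of a vertex-weighted graph. -/
def weightedAut {V : Type*} (Γ : SimpleGraph V) (w : V → ℕ) : Subgroup (Γ ≃g Γ) where
  carrier := {φ | ∀ v, w (φ v) = w v}
  one_mem' := fun _ => rfl
  mul_mem' := fun {φ ψ} hφ hψ v => (hφ (ψ v)).trans (hψ v)
  inv_mem' := fun {φ} hφ v => by
    have h := hφ (φ⁻¹ v)
    rw [RelIso.apply_inv_self] at h
    exact h.symm

/-- The open neighbourhood `N(x)` in the power graph of `G`, as a set of elements of `G`. -/
def nbhd {G : Type*} [Group G] (x : G) : Set G :=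
  {g | ∃ (hx : x ≠ 1) (hg : g ≠ 1), (powerGraph G).Adj ⟨x, hx⟩ ⟨g, hg⟩}

/-- The set of vertices `N(x) - ⟨x⟩` of the power graph. -/
def hatSet {G : Type*} [Group G] (x : G) : Set {g : G // g ≠ 1} :=
  {v | (v : G) ∈ nbhd x ∧ (v : G) ∉ Subgroup.zpowers x}

/-- The subgraph of the power graph induced on `N(x) - ⟨x⟩`. -/
def hatBase {G : Type*} [Group G] (x : G) : SimpleGraph (hatSet x) :=
  (powerGraph G).induce (hatSet x)

/-- The group `Aut(x̂)`, where `x̂` is the weighted quotient of the subgraph induced on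
`N(x) - ⟨x⟩`. -/
abbrev AutHat {G : Type*} [Group G] (x : G) : Type _ :=
  weightedAut (menQuotient (hatBase x)) (menWeight (hatBase x))

/-- The wreath product `A ≀ S_k`, with respect to the natural action of `S_k` on `k` points. -/
abbrev WreathSym (A : Type*) [Group A] (k : ℕ) : Type _ :=
  (Fin k → A) ⋊[(mulAutArrow : Equiv.Perm (Fin k) →* MulAut (Fin k → A))] Equiv.Perm (Fin k)

/-- `x` has height `p ^ n`: this is the largest power of `p` such that `x ∈ G ^ (p ^ n)`. -/
def HasHeight {G : Type*} [CommGroup G] (p : ℕ) (x : G) (n : ℕ) : Prop :=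
  IsGreatest {k : ℕ | ∃ y : G, y ^ p ^ k = x} n

/-- `Ω_n(G) = {x | x ^ (p ^ n) = 1}`. -/
def Omega (p n : ℕ) (G : Type*) [CommGroup G] : Subgroup G :=
  (powMonoidHom (p ^ n) : G →* G).ker

/-- `H_n(G)`: the elements of order `p` and of height `p ^ (n - 1)` in `G`. -/
def HSet (p n : ℕ) (G : Type*) [CommGroup G] : Set G :=
  {x | orderOf x = p ∧ ∃ k : ℕ, k + 1 = n ∧ HasHeight p x k}

/-- The choices attached to an element `b` of height `p ^ t` of a finite abelian `p`-group:
a root `a`, a complement `L` of `⟨a⟩` in `⟨N(b)⟩`, a decomposition of `L` into homocyclic groups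
of different exponents, and the elements `x_i` and `c`. The factors are indexed by
`Fin (m' + 1)`, where `m' + 1 = m`, and the last of them is the one called `L_m`. -/
structure Decomp {G : Type*} [CommGroup G] (p : ℕ) (b : G) (t : ℕ) where
  /-- the root of `b` -/
  a : G
  a_pow : a ^ p ^ t = b
  /-- the complement of `⟨a⟩` in `⟨N(b)⟩` -/
  L : Subgroup G
  disjoint_L : Disjoint L (Subgroup.zpowers a)
  sup_L : L ⊔ Subgroup.zpowers a = Subgroup.closure (nbhd b)
  /-- the number `m - 1` of homocyclic factors before the last one -/
  m' : ℕ
  /-- the homocyclic factors of `L` -/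
  F : Fin (m' + 1) → Subgroup G
  indep_F : iSupIndep F
  iSup_F : ⨆ i, F i = L
  /-- the exponent of `F i` is `s_i = p ^ e i` (if `F i` is nontrivial) -/
  e : Fin (m' + 1) → ℕ
  e_pos : ∀ i, 0 < e i
  e_strictMono : StrictMono e
  e_last : e (Fin.last m') = t
  /-- the number of cyclic direct factors of `F i` -/
  r : Fin (m' + 1) → ℕ
  /-- only the last factor may be trivial -/
  r_pos : ∀ i : Fin m', 0 < r i.castSucc
  homocyclic : ∀ i, Nonempty (F i ≃* (Fin (r i) → Multiplicative (ZMod (p ^ e i))))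
  /-- the elements `x_i ∈ H_{e i}(Ω_{t+1}(L))`, for `i < m` -/
  x : (i : Fin m') → HSet p (e i.castSucc) (Omega p (t + 1) L)
  /-- the element `c` of order `p · o(b)` in `⟨a⟩` -/
  c : G
  c_mem : c ∈ Subgroup.zpowers a
  orderOf_c : orderOf c = p * orderOf b

/-- The element `(x_i, c)` of `L × ⟨a⟩ = ⟨N(b)⟩`. -/
def Decomp.pair {G : Type*} [CommGroup G] {p : ℕ} {b : G} {t : ℕ} (D : Decomp p b t)
    (i : Fin D.m') : G :=
  (((D.x i : Omega p (t + 1) D.L) : D.L) : G) * D.c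

/-- `k_i = |H_{e i}(Ω_{t+1}(L))|`, for `i < m`. -/
noncomputable def Decomp.k {G : Type*} [CommGroup G] {p : ℕ} {b : G} {t : ℕ} (D : Decomp p b t)
    (i : Fin D.m') : ℕ :=
  Nat.card (HSet p (D.e i.castSucc) (Omega p (t + 1) D.L))

end PowerGraphAut

/-! The vertices of `hatBase b` are the elements `v` outside `⟨b⟩` with `b ∈ ⟨v⟩`. In the cyclic
`p`-group `⟨v⟩` exactly one subgroup of order `p · o(b)` lies above `b`. In `⟨N(b)⟩ = L × ⟨a⟩` that
subgroup has exactly one generator `y c` with `y ∈ L` and `y ^ p = 1`. So `hatBase b` is the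
disjoint union, over such `y`, of the cones `coneBase (y c)` of elements having `y c` as a power
(`nonempty_sigmaGraph_iso_hatBase`). A cone is connected, because its apex dominates it. It differs
from `hatBase (y c)` only by dominating vertices, and these do not affect the automorphism group of
the weighted quotient (`nonempty_autMen_coneBase_mulEquiv_autHat`).

Cones are classified by the height of `y` in `L`, cut off at `t - 1`. If the height is `e_i - 1 < t
- 1`, an automorphism of `L` moves `x_i` to `y`. If `y` is a `p ^ (t - 1)`-th power, a shear of `L ×
⟨a⟩` moves `c` to `y c`. Conversely, the size of a cone is a strictly increasing function of the
height of its apex, once the order of the apex is fixed (`card_coneSet`). Since the total weight of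
a component is its number of vertices, a weighted automorphism cannot mix classes, and the group is
a product of wreath products (`nonempty_wreath_mulEquiv_autMen`).

For existence, every `p ^ t`-th power of an element of `⟨N(b)⟩` lies in `⟨b⟩`. Hence `o(a) = p ^ t ·
o(b)` is an exponent of `⟨N(b)⟩`, `⟨a⟩` has a complement, and that complement is killed by `p ^ t`.
-/

namespace PowerGraphAut

/-! ### Automorphisms of weighted graphs and dominating vertices -/

section Weighted

variable {V V' : Type*} {Γ : SimpleGraph V} {Γ' : SimpleGraph V'} {w : V → ℕ} {w' : V' → ℕ}

/-- A weight-preserving isomorphism induces an isomorphism of automorphism groups. -/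
def weightedAutCongr (e : Γ ≃g Γ') (h : ∀ v, w' (e v) = w v) :
    weightedAut Γ w ≃* weightedAut Γ' w' where
  toFun φ := ⟨(e.symm.trans φ.1).trans e, fun v => by
    have h1 := φ.2 (e.symm v)
    have h2 := h (e.symm v)
    rw [RelIso.apply_symm_apply] at h2
    exact (h _).trans (h1.trans h2.symm)⟩
  invFun φ := ⟨(e.trans φ.1).trans e.symm, fun v => by
    have h1 := φ.2 (e v)
    have h2 := h (e.symm (φ.1 (e v)))
    rw [RelIso.apply_symm_apply] at h2
    exact h2.symm.trans (h1.trans (h v))⟩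
  left_inv φ := by
    ext v
    simp
  right_inv φ := by
    ext v
    simp
  map_mul' φ ψ := by
    ext v
    simp [RelIso.mul_apply]

/-- A vertex adjacent to all other vertices. -/
def IsDominating (Γ : SimpleGraph V) (v : V) : Prop := ∀ u, u ≠ v → Γ.Adj v u

theorem isDominating_apply_iff (e : Γ ≃g Γ') (v : V) :
    IsDominating Γ' (e v) ↔ IsDominating Γ v := by
  constructor
  · intro h u hu
    exact e.map_rel_iff.1 (h (e u) (fun h' => hu (e.injective h')))
  · intro h u hu
    obtain ⟨u, rfl⟩ := e.surjective u
    exact e.map_rel_iff.2 (h u (fun h' => hu (by rw [h'])))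

/-- A unique dominating vertex can be removed without changing the automorphism group. -/
theorem nonempty_weightedAut_mulEquiv_induce_not_isDominating
    (hsub : ∀ u v, IsDominating Γ u → IsDominating Γ v → u = v) :
    Nonempty (weightedAut Γ w ≃*
      weightedAut (Γ.induce {v | ¬ IsDominating Γ v}) (fun v => w v)) := by
  classical
  let res (φ : weightedAut Γ w) :
      weightedAut (Γ.induce {v | ¬ IsDominating Γ v}) (fun v => w v) :=
    ⟨{ toEquiv := φ.1.toEquiv.subtypeEquiv
          (fun v => not_congr (isDominating_apply_iff φ.1 v).symm)
       map_rel_iff' := by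
          intro u v
          exact φ.1.map_rel_iff }, fun v => φ.2 v⟩
  have hres : ∀ φ v, ((res φ).1 v : V) = φ.1 v := fun φ v => rfl
  have hfix : ∀ (φ : weightedAut Γ w) v, IsDominating Γ v → φ.1 v = v := fun φ v hv =>
    hsub _ _ ((isDominating_apply_iff φ.1 v).2 hv) hv
  let f : weightedAut Γ w →* weightedAut (Γ.induce {v | ¬ IsDominating Γ v}) (fun v => w v) :=
    { toFun := res
      map_one' := by
        ext v
        rfl
      map_mul' := fun φ ψ => by
        ext v
        rfl }
  refine ⟨MulEquiv.ofBijective f ⟨?_, ?_⟩⟩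
  · intro φ ψ h
    ext v
    by_cases hv : IsDominating Γ v
    · rw [hfix φ v hv, hfix ψ v hv]
    · have := congrArg (fun χ => ((χ.1 ⟨v, hv⟩ : {v | ¬ IsDominating Γ v}) : V)) h
      exact this
  · intro ψ
    -- Extend `ψ` by fixing the dominating vertex; its adjacencies hold on both sides automatically.
    let σ : Equiv.Perm V := Equiv.Perm.ofSubtype (p := fun v => ¬ IsDominating Γ v) ψ.1.toEquiv
    have h1 : ∀ v (hv : ¬ IsDominating Γ v), σ v = (ψ.1 ⟨v, hv⟩ : V) := fun v hv =>
      Equiv.Perm.ofSubtype_apply_of_mem (p := fun v => ¬ IsDominating Γ v) ψ.1.toEquiv hv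
    have h2 : ∀ v, IsDominating Γ v → σ v = v := fun v hv =>
      Equiv.Perm.ofSubtype_apply_of_not_mem (p := fun v => ¬ IsDominating Γ v) ψ.1.toEquiv
        (not_not.2 hv)
    have hadj : ∀ u v, Γ.Adj (σ u) (σ v) ↔ Γ.Adj u v := by
      intro u v
      by_cases huv : u = v
      · subst huv
        simp
      have huv' : σ u ≠ σ v := fun h => huv (σ.injective h)
      by_cases hu : IsDominating Γ u
      · have ha := hu v (Ne.symm huv)
        have hb := hu (σ v) (by rw [← h2 u hu]; exact huv'.symm)
        rw [h2 u hu]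
        exact iff_of_true hb ha
      · by_cases hv : IsDominating Γ v
        · have ha := hv u huv
          have hb := hv (σ u) (by rw [← h2 v hv]; exact huv')
          rw [h2 v hv]
          exact iff_of_true hb.symm ha.symm
        · rw [h1 u hu, h1 v hv]
          exact ψ.1.map_rel_iff (a := ⟨u, hu⟩) (b := ⟨v, hv⟩)
    refine ⟨⟨⟨σ, fun {u v} => hadj u v⟩, ?_⟩, ?_⟩
    · intro v
      change w (σ v) = w v
      by_cases hv : IsDominating Γ v
      · rw [h2 v hv]
      · rw [h1 v hv]
        exact ψ.2 ⟨v, hv⟩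
    · ext v
      exact h1 v v.2

end Weighted

/-! ### The quotient by equality of closed neighbourhoods -/

section MenQuotient

variable {V V' : Type*} {Γ : SimpleGraph V} {Γ' : SimpleGraph V'}

theorem mem_closedNbhd {u v : V} : v ∈ closedNbhd Γ u ↔ v = u ∨ Γ.Adj u v := Iff.rfl

/-- The class of a vertex. -/
abbrev menMk (Γ : SimpleGraph V) (v : V) : Quotient (menSetoid Γ) := Quotient.mk (menSetoid Γ) v

theorem menMk_eq_iff {u v : V} : menMk Γ u = menMk Γ v ↔ closedNbhd Γ u = closedNbhd Γ v :=
  Quotient.eq (r := menSetoid Γ)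

/-- Members of a class share their closed neighbourhood, so adjacency of distinct classes can be
tested on any representatives. -/
theorem menQuotient_adj_mk {u v : V} :
    (menQuotient Γ).Adj (menMk Γ u) (menMk Γ v) ↔ menMk Γ u ≠ menMk Γ v ∧ Γ.Adj u v := by
  constructor
  · rintro ⟨hne, x, y, hx, hy, hxy⟩
    refine ⟨hne, ?_⟩
    have h1 : y ∈ closedNbhd Γ u := menMk_eq_iff.1 hx ▸ mem_closedNbhd.2 (Or.inr hxy)
    rcases mem_closedNbhd.1 h1 with h | h
    · exact absurd (h ▸ hy) hne
    have h2 : u ∈ closedNbhd Γ v := menMk_eq_iff.1 hy ▸ mem_closedNbhd.2 (Or.inr h.symm)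
    rcases mem_closedNbhd.1 h2 with h' | h'
    · exact absurd (congrArg _ h') hne
    · exact h'.symm
  · rintro ⟨hne, h⟩
    exact ⟨hne, u, v, rfl, rfl, h⟩

theorem isDominating_iff_closedNbhd {v : V} : IsDominating Γ v ↔ closedNbhd Γ v = Set.univ := by
  rw [Set.eq_univ_iff_forall]
  refine forall_congr' fun u => ?_
  rw [mem_closedNbhd]
  tauto

theorem isDominating_menMk {v : V} : IsDominating (menQuotient Γ) (menMk Γ v) ↔
    IsDominating Γ v := by
  constructor
  · intro h u hu
    by_cases huv : menMk Γ u = menMk Γ v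
    · have : u ∈ closedNbhd Γ v := menMk_eq_iff.1 huv ▸ mem_closedNbhd.2 (Or.inl rfl)
      exact (mem_closedNbhd.1 this).resolve_left hu
    · exact (menQuotient_adj_mk.1 (h _ huv)).2
  · intro h A
    induction A using Quotient.inductionOn with
    | h u =>
      intro hu
      exact menQuotient_adj_mk.2 ⟨Ne.symm hu, h u (fun h' => hu (by rw [h']))⟩

/-- All dominating vertices have the whole vertex set as closed neighbourhood, hence form a single
class. -/
theorem eq_of_isDominating_menQuotient (A B : Quotient (menSetoid Γ))
    (hA : IsDominating (menQuotient Γ) A) (hB : IsDominating (menQuotient Γ) B) : A = B := by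
  induction A using Quotient.inductionOn with
  | h u =>
    induction B using Quotient.inductionOn with
    | h v =>
      rw [isDominating_menMk, isDominating_iff_closedNbhd] at hA hB
      exact menMk_eq_iff.2 (hA.trans hB.symm)

theorem closedNbhd_apply_eq_iff (e : Γ ≃g Γ') {u v : V} :
    closedNbhd Γ' (e u) = closedNbhd Γ' (e v) ↔ closedNbhd Γ u = closedNbhd Γ v := by
  have key : ∀ u, closedNbhd Γ' (e u) = e '' closedNbhd Γ u := by
    intro u
    ext x
    obtain ⟨x, rfl⟩ := e.surjective x
    rw [e.injective.mem_set_image, mem_closedNbhd, mem_closedNbhd, e.injective.eq_iff,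
      e.map_rel_iff]
  rw [key, key, e.injective.image_injective.eq_iff]

/-- An isomorphism of graphs induces an isomorphism of the quotient graphs. -/
def menQuotientCongr (e : Γ ≃g Γ') : menQuotient Γ ≃g menQuotient Γ' where
  toEquiv := Quotient.congr e.toEquiv fun _ _ => (closedNbhd_apply_eq_iff e).symm
  map_rel_iff' := by
    intro A B
    induction A using Quotient.inductionOn with
    | h u =>
      induction B using Quotient.inductionOn with
      | h v =>
        change (menQuotient Γ').Adj (menMk Γ' (e u)) (menMk Γ' (e v)) ↔
          (menQuotient Γ).Adj (menMk Γ u) (menMk Γ v)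
        rw [menQuotient_adj_mk, menQuotient_adj_mk, e.map_rel_iff, Ne, Ne, menMk_eq_iff,
          menMk_eq_iff, closedNbhd_apply_eq_iff]

theorem menWeight_menQuotientCongr (e : Γ ≃g Γ') (A : Quotient (menSetoid Γ)) :
    menWeight Γ' (menQuotientCongr e A) = menWeight Γ A := by
  induction A using Quotient.inductionOn with
  | h u =>
    refine (Nat.card_congr (e.toEquiv.subtypeEquiv fun v => ?_)).symm
    change menMk Γ v = menMk Γ u ↔ menMk Γ' (e v) = menMk Γ' (e u)
    rw [menMk_eq_iff, menMk_eq_iff, closedNbhd_apply_eq_iff]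

/-- The automorphism group of the weighted quotient graph. -/
abbrev AutMen (Γ : SimpleGraph V) : Type _ := weightedAut (menQuotient Γ) (menWeight Γ)

/-- Isomorphic graphs have isomorphic automorphism groups of weighted quotients. -/
noncomputable def autMenCongr (e : Γ ≃g Γ') : AutMen Γ ≃* AutMen Γ' :=
  weightedAutCongr (menQuotientCongr e) (menWeight_menQuotientCongr e)

/-- Removing dominating vertices does not change the automorphism group of the weighted
quotient. -/
theorem nonempty_autMen_mulEquiv_of_isDominating (f : Γ ↪g Γ')
    (hf : ∀ v, v ∉ Set.range f → IsDominating Γ' v) : Nonempty (AutMen Γ ≃* AutMen Γ') := by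
  -- Every vertex outside the range is adjacent to all of the range, so closed neighbourhoods only
  -- grow by one fixed set and the classes are unchanged.
  have hN : ∀ u, closedNbhd Γ' (f u) = f '' closedNbhd Γ u ∪ (Set.range f)ᶜ := by
    intro u
    ext x
    by_cases hx : x ∈ Set.range f
    · obtain ⟨x, rfl⟩ := hx
      simp only [mem_closedNbhd, Set.mem_union, f.injective.mem_set_image, f.injective.eq_iff,
        f.map_rel_iff, Set.mem_compl_iff, Set.mem_range_self, not_true, or_false]
    · have h1 : x ∈ closedNbhd Γ' (f u) := by
        refine mem_closedNbhd.2 (Or.inr (hf x hx (f u) ?_).symm)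
        rintro rfl
        exact hx ⟨u, rfl⟩
      exact iff_of_true h1 (Or.inr hx)
  have hEq : ∀ u v, menMk Γ' (f u) = menMk Γ' (f v) ↔ menMk Γ u = menMk Γ v := by
    intro u v
    rw [menMk_eq_iff, menMk_eq_iff]
    refine ⟨fun h => ?_, fun h => by rw [hN, hN, h]⟩
    have : ∀ u, f ⁻¹' closedNbhd Γ' (f u) = closedNbhd Γ u := by
      intro u
      rw [hN, Set.preimage_union, Set.preimage_image_eq _ f.injective, Set.preimage_compl,
        Set.preimage_range, Set.compl_univ, Set.union_empty]
    rw [← this u, ← this v, h]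
  have hDom : ∀ u, IsDominating Γ' (f u) ↔ IsDominating Γ u := by
    intro u
    constructor
    · intro h v hv
      exact f.map_rel_iff.1 (h _ (fun h' => hv (f.injective h')))
    · intro h v hv
      by_cases hx : v ∈ Set.range f
      · obtain ⟨v, rfl⟩ := hx
        exact f.map_rel_iff.2 (h _ (fun h' => hv (by rw [h'])))
      · exact (hf v hx (f u) (Ne.symm hv)).symm
  let F : Quotient (menSetoid Γ) → Quotient (menSetoid Γ') :=
    Quotient.map f (fun u v h => menMk_eq_iff.1 ((hEq u v).2 (menMk_eq_iff.2 h)))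
  have hFmk : ∀ u, F (menMk Γ u) = menMk Γ' (f u) := fun u => rfl
  have hFinj : Function.Injective F := by
    intro A B
    induction A using Quotient.inductionOn with
    | h u =>
      induction B using Quotient.inductionOn with
      | h v => exact (hEq u v).1
  have hFdom : ∀ A, IsDominating (menQuotient Γ') (F A) ↔ IsDominating (menQuotient Γ) A := by
    intro A
    induction A using Quotient.inductionOn with
    | h u => exact isDominating_menMk.trans ((hDom u).trans isDominating_menMk.symm)
  have hFadj : ∀ A B, (menQuotient Γ').Adj (F A) (F B) ↔ (menQuotient Γ).Adj A B := by
    intro A B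
    induction A using Quotient.inductionOn with
    | h u =>
      induction B using Quotient.inductionOn with
      | h v =>
        change (menQuotient Γ').Adj (menMk Γ' (f u)) (menMk Γ' (f v)) ↔
          (menQuotient Γ).Adj (menMk Γ u) (menMk Γ v)
        rw [menQuotient_adj_mk, menQuotient_adj_mk, Ne, Ne, hEq, f.map_rel_iff]
  -- Only the dominating class can gain members from outside the range of `f`.
  have hFw : ∀ A, ¬ IsDominating (menQuotient Γ) A → menWeight Γ' (F A) = menWeight Γ A := by
    intro A
    induction A using Quotient.inductionOn with
    | h u =>
      intro hA
      let g : {x : V // menMk Γ x = menMk Γ u} → {x : V' // menMk Γ' x = menMk Γ' (f u)} :=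
        fun x => ⟨f x, (hEq _ _).2 x.2⟩
      refine (Nat.card_congr (Equiv.ofBijective g ⟨?_, ?_⟩)).symm
      · intro x y h
        exact Subtype.ext (f.injective (congrArg Subtype.val h))
      · rintro ⟨x, hx⟩
        by_cases hxr : x ∈ Set.range f
        · obtain ⟨x, rfl⟩ := hxr
          exact ⟨⟨x, (hEq _ _).1 hx⟩, rfl⟩
        · refine absurd ?_ hA
          rw [← hFdom]
          change IsDominating (menQuotient Γ') (menMk Γ' (f u))
          rw [← hx, isDominating_menMk]
          exact hf x hxr
  let G : {A | ¬ IsDominating (menQuotient Γ) A} → {A | ¬ IsDominating (menQuotient Γ') A} :=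
    fun A => ⟨F A, fun h => A.2 ((hFdom _).1 h)⟩
  have hG : Function.Bijective G := by
    refine ⟨fun A B h => Subtype.ext (hFinj (congrArg Subtype.val h)), ?_⟩
    rintro ⟨A, hA⟩
    induction A using Quotient.inductionOn with
    | h x =>
      have hx : x ∈ Set.range f := by
        by_contra hx
        exact hA (isDominating_menMk.2 (hf x hx))
      obtain ⟨x, rfl⟩ := hx
      exact ⟨⟨menMk Γ x, fun h => hA ((hFdom _).2 h)⟩, rfl⟩
  let e : (menQuotient Γ).induce {A | ¬ IsDominating (menQuotient Γ) A} ≃g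
      (menQuotient Γ').induce {A | ¬ IsDominating (menQuotient Γ') A} :=
    ⟨Equiv.ofBijective G hG, fun {A B} => hFadj A B⟩
  -- `Γ` may or may not have a dominating class of its own, so both quotients are stripped of theirs
  -- before being compared.
  obtain ⟨e1⟩ := nonempty_weightedAut_mulEquiv_induce_not_isDominating (w := menWeight Γ)
    (eq_of_isDominating_menQuotient (Γ := Γ))
  obtain ⟨e2⟩ := nonempty_weightedAut_mulEquiv_induce_not_isDominating (w := menWeight Γ')
    (eq_of_isDominating_menQuotient (Γ := Γ'))
  exact ⟨(e1.trans (weightedAutCongr e fun A => hFw A A.2)).trans e2.symm⟩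

end MenQuotient

/-! ### Disjoint unions of graphs -/

section Sigma

variable {Q Q' : Type*} {V : Q → Type*} {V' : Q' → Type*}

/-- The disjoint union of a family of graphs. -/
def sigmaGraph (Γ : ∀ q, SimpleGraph (V q)) : SimpleGraph (Σ q, V q) where
  Adj a b := ∃ (q : Q) (u v : V q), a = ⟨q, u⟩ ∧ b = ⟨q, v⟩ ∧ (Γ q).Adj u v
  symm := ⟨fun _ _ ⟨q, u, v, ha, hb, h⟩ => ⟨q, v, u, hb, ha, h.symm⟩⟩
  loopless := ⟨by
    rintro _ ⟨q, u, v, rfl, hb, h⟩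
    obtain rfl : u = v := eq_of_heq (Sigma.mk.inj hb).2
    exact h.ne rfl⟩

variable {Γ : ∀ q, SimpleGraph (V q)} {Γ' : ∀ q, SimpleGraph (V' q)}

theorem sigmaGraph_adj_mk {q : Q} {u v : V q} :
    (sigmaGraph Γ).Adj ⟨q, u⟩ ⟨q, v⟩ ↔ (Γ q).Adj u v := by
  constructor
  · rintro ⟨q', u', v', ha, hb, h⟩
    obtain ⟨rfl, hu⟩ := Sigma.mk.inj ha
    obtain ⟨-, hv⟩ := Sigma.mk.inj hb
    rwa [eq_of_heq hu, eq_of_heq hv]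
  · exact fun h => ⟨q, u, v, rfl, rfl, h⟩

theorem fst_eq_of_sigmaGraph_adj {a b : Σ q, V q} (h : (sigmaGraph Γ).Adj a b) :
    a.1 = b.1 := by
  obtain ⟨q, u, v, rfl, rfl, -⟩ := h
  rfl

/-- Disjoint unions of isomorphic graphs are isomorphic. -/
def sigmaGraphCongr (e : Q ≃ Q') (f : ∀ q, Γ q ≃g Γ' (e q)) :
    sigmaGraph Γ ≃g sigmaGraph Γ' where
  toEquiv := Equiv.sigmaCongr e fun q => (f q).toEquiv
  map_rel_iff' := by
    rintro ⟨q, u⟩ ⟨q', v⟩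
    change (sigmaGraph Γ').Adj ⟨e q, f q u⟩ ⟨e q', f q' v⟩ ↔ _
    by_cases hq : q = q'
    · subst hq
      rw [sigmaGraph_adj_mk, sigmaGraph_adj_mk, (f q).map_rel_iff]
    · exact iff_of_false (fun h => hq (e.injective (fst_eq_of_sigmaGraph_adj h)))
        (fun h => hq (fst_eq_of_sigmaGraph_adj h))

theorem mem_closedNbhd_sigmaGraph {q : Q} {u : V q} {b : Σ q, V q} :
    b ∈ closedNbhd (sigmaGraph Γ) ⟨q, u⟩ ↔ ∃ v ∈ closedNbhd (Γ q) u, b = ⟨q, v⟩ := by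
  rw [mem_closedNbhd]
  constructor
  · rintro (rfl | h)
    · exact ⟨u, Or.inl rfl, rfl⟩
    · obtain ⟨q', v⟩ := b
      obtain rfl : q = q' := fst_eq_of_sigmaGraph_adj h
      exact ⟨v, Or.inr (sigmaGraph_adj_mk.1 h), rfl⟩
  · rintro ⟨v, rfl | hv, rfl⟩
    · exact Or.inl rfl
    · exact Or.inr (sigmaGraph_adj_mk.2 hv)

theorem menMk_sigmaGraph_eq_iff {q : Q} {u v : V q} :
    menMk (sigmaGraph Γ) ⟨q, u⟩ = menMk (sigmaGraph Γ) ⟨q, v⟩ ↔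
      menMk (Γ q) u = menMk (Γ q) v := by
  rw [menMk_eq_iff, menMk_eq_iff]
  have key : ∀ u x : V q, (⟨q, x⟩ : Σ q, V q) ∈ closedNbhd (sigmaGraph Γ) ⟨q, u⟩ ↔
      x ∈ closedNbhd (Γ q) u := by
    intro u x
    rw [mem_closedNbhd_sigmaGraph]
    constructor
    · rintro ⟨v, hv, h⟩
      obtain rfl : x = v := eq_of_heq (Sigma.mk.inj h).2
      exact hv
    · exact fun h => ⟨x, h, rfl⟩
  constructor
  · intro h
    ext x
    rw [← key, ← key, h]
  · intro h
    ext x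
    rw [mem_closedNbhd_sigmaGraph, mem_closedNbhd_sigmaGraph, h]

theorem fst_eq_of_menMk_sigmaGraph_eq {a b : Σ q, V q}
    (h : menMk (sigmaGraph Γ) a = menMk (sigmaGraph Γ) b) : a.1 = b.1 := by
  have : a ∈ closedNbhd (sigmaGraph Γ) b := menMk_eq_iff.1 h ▸ Or.inl rfl
  rcases mem_closedNbhd.1 this with h | h
  · rw [h]
  · exact (fst_eq_of_sigmaGraph_adj h).symm

/-- The quotient of a disjoint union is the disjoint union of the quotients. -/
def sigmaMenToMenSigma (Γ : ∀ q, SimpleGraph (V q)) (A : Σ q, Quotient (menSetoid (Γ q))) :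
    Quotient (menSetoid (sigmaGraph Γ)) :=
  Quotient.liftOn A.2 (fun u => menMk (sigmaGraph Γ) ⟨A.1, u⟩)
    (fun _ _ h => menMk_sigmaGraph_eq_iff.2 (menMk_eq_iff.2 h))

theorem bijective_sigmaMenToMenSigma (Γ : ∀ q, SimpleGraph (V q)) :
    Function.Bijective (sigmaMenToMenSigma Γ) := by
  constructor
  · rintro ⟨q, A⟩ ⟨q', B⟩
    induction A using Quotient.inductionOn with
    | h u =>
      induction B using Quotient.inductionOn with
      | h v =>
        intro h
        obtain rfl : q = q' := fst_eq_of_menMk_sigmaGraph_eq h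
        congr 1
        exact menMk_sigmaGraph_eq_iff.1 h
  · intro A
    induction A using Quotient.inductionOn with
    | h a => exact ⟨⟨a.1, menMk (Γ a.1) a.2⟩, rfl⟩

/-- The quotient of a disjoint union is the disjoint union of the quotients. -/
noncomputable def sigmaMenIso (Γ : ∀ q, SimpleGraph (V q)) :
    sigmaGraph (fun q => menQuotient (Γ q)) ≃g menQuotient (sigmaGraph Γ) where
  toEquiv := Equiv.ofBijective _ (bijective_sigmaMenToMenSigma Γ)
  map_rel_iff' := by
    rintro ⟨q, A⟩ ⟨q', B⟩
    induction A using Quotient.inductionOn with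
    | h u =>
      induction B using Quotient.inductionOn with
      | h v =>
        change (menQuotient (sigmaGraph Γ)).Adj (menMk _ ⟨q, u⟩) (menMk _ ⟨q', v⟩) ↔
          (sigmaGraph fun q => menQuotient (Γ q)).Adj ⟨q, menMk _ u⟩ ⟨q', menMk _ v⟩
        by_cases hq : q = q'
        · subst hq
          rw [sigmaGraph_adj_mk, menQuotient_adj_mk, menQuotient_adj_mk, sigmaGraph_adj_mk, Ne, Ne,
            menMk_sigmaGraph_eq_iff]
        · exact iff_of_false
            (fun h => hq (fst_eq_of_sigmaGraph_adj (menQuotient_adj_mk.1 h).2))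
            (fun h => hq (fst_eq_of_sigmaGraph_adj h))

theorem menWeight_sigmaMenIso (Γ : ∀ q, SimpleGraph (V q))
    (A : Σ q, Quotient (menSetoid (Γ q))) :
    menWeight (sigmaGraph Γ) (sigmaMenIso Γ A) = menWeight (Γ A.1) A.2 := by
  obtain ⟨q, A⟩ := A
  induction A using Quotient.inductionOn with
  | h u =>
    let g : {x : V q // menMk (Γ q) x = menMk (Γ q) u} →
        {x : Σ q, V q // menMk (sigmaGraph Γ) x = menMk (sigmaGraph Γ) ⟨q, u⟩} :=
      fun x => ⟨⟨q, x⟩, menMk_sigmaGraph_eq_iff.2 x.2⟩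
    refine (Nat.card_congr (Equiv.ofBijective g ⟨?_, ?_⟩)).symm
    · intro x y h
      exact Subtype.ext (eq_of_heq (Sigma.mk.inj (congrArg Subtype.val h)).2)
    · rintro ⟨⟨q', x⟩, hx⟩
      obtain rfl : q' = q := fst_eq_of_menMk_sigmaGraph_eq hx
      exact ⟨⟨x, menMk_sigmaGraph_eq_iff.1 hx⟩, rfl⟩

/-- The automorphism group of the weighted quotient of a disjoint union. -/
noncomputable def autMenSigma (Γ : ∀ q, SimpleGraph (V q)) :
    weightedAut (sigmaGraph fun q => menQuotient (Γ q)) (fun A => menWeight (Γ A.1) A.2) ≃*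
      AutMen (sigmaGraph Γ) :=
  weightedAutCongr (sigmaMenIso Γ) (menWeight_sigmaMenIso Γ)

end Sigma

/-! ### Disjoint unions whose parts have a dominating vertex -/

section Hub

variable {Q : Type*} {V : Q → Type*} {Γ : ∀ q, SimpleGraph (V q)}

/-- An automorphism of a disjoint union of graphs with dominating vertices permutes the parts. -/
theorem exists_fst_of_sigmaGraph_iso (hub : ∀ q, V q) (hhub : ∀ q, IsDominating (Γ q) (hub q))
    (φ : sigmaGraph Γ ≃g sigmaGraph Γ) (q : Q) : ∃ q', ∀ u, ∃ u', φ ⟨q, u⟩ = ⟨q', u'⟩ := by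
  refine ⟨(φ ⟨q, hub q⟩).1, fun u => ?_⟩
  have key : (φ ⟨q, hub q⟩).1 = (φ ⟨q, u⟩).1 := by
    by_cases hu : u = hub q
    · rw [hu]
    · exact fst_eq_of_sigmaGraph_adj (φ.map_rel_iff.2 (sigmaGraph_adj_mk.2 (hhub q u hu)))
  rw [key]
  exact ⟨_, rfl⟩

/-- An automorphism of a weighted disjoint union of graphs with dominating vertices preserves the
total weight of the parts. -/
theorem sum_weight_eq_of_sigmaGraph_iso [∀ q, Fintype (V q)] {w : ∀ q, V q → ℕ}
    (hub : ∀ q, V q) (hhub : ∀ q, IsDominating (Γ q) (hub q))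
    {φ : sigmaGraph Γ ≃g sigmaGraph Γ}
    (hφ : φ ∈ weightedAut (sigmaGraph Γ) (fun a => w a.1 a.2)) (a : Σ q, V q) :
    ∑ u, w (φ a).1 u = ∑ u, w a.1 u := by
  obtain ⟨q, v⟩ := a
  obtain ⟨q', h⟩ := exists_fst_of_sigmaGraph_iso hub hhub φ q
  obtain ⟨v', hv'⟩ := h v
  obtain ⟨q'', h'⟩ := exists_fst_of_sigmaGraph_iso hub hhub φ.symm q'
  obtain rfl : q'' = q := by
    obtain ⟨x, hx⟩ := h' v'
    rw [← hv', RelIso.symm_apply_apply] at hx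
    exact (Sigma.mk.inj hx).1.symm
  choose g hg using h
  choose g' hg' using h'
  rw [hv']
  refine (Fintype.sum_equiv (⟨g, g', fun u => ?_, fun u => ?_⟩ : V q'' ≃ V q') _ _
    fun u => ?_).symm
  · have := φ.symm_apply_apply ⟨q'', u⟩
    rw [hg, hg'] at this
    exact eq_of_heq (Sigma.mk.inj this).2
  · have := φ.apply_symm_apply ⟨q', u⟩
    rw [hg', hg] at this
    exact eq_of_heq (Sigma.mk.inj this).2
  · have := hφ ⟨q'', u⟩
    rw [hg] at this
    exact this.symm

/-- The total weight of the weighted quotient is the number of vertices. -/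
theorem sum_menWeight {V : Type*} [Finite V] (Γ : SimpleGraph V)
    [Fintype (Quotient (menSetoid Γ))] : ∑ A, menWeight Γ A = Nat.card V := by
  rw [← Nat.card_congr (Equiv.sigmaFiberEquiv (menMk Γ)), Nat.card_sigma]
  rfl

end Hub

/-! ### Wreath products acting on copies of connected graphs -/

section Wreath

variable {J : Type*} {W : J → Type*} (Δ : ∀ j, SimpleGraph (W j)) (w : ∀ j, W j → ℕ) (k : J → ℕ)

/-- The disjoint union of `k j` copies of each graph `Δ j`. -/
abbrev copiesGraph : SimpleGraph (Σ q : (Σ j, Fin (k j)), W q.1) :=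
  sigmaGraph fun q : (Σ j, Fin (k j)) => Δ q.1

/-- The weight function on the disjoint union of copies. -/
abbrev copiesWeight : (Σ q : (Σ j, Fin (k j)), W q.1) → ℕ := fun a => w a.1.1 a.2

variable {Δ w k}

/-- The action of a family of elements of wreath products on the union of copies. -/
def wreathAct (F : ∀ j, WreathSym (weightedAut (Δ j) (w j)) (k j))
    (a : Σ q : (Σ j, Fin (k j)), W q.1) : Σ q : (Σ j, Fin (k j)), W q.1 :=
  ⟨⟨a.1.1, (F a.1.1).right a.1.2⟩, ((F a.1.1).left ((F a.1.1).right a.1.2)).1 a.2⟩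

theorem wreathAct_mul (F F' : ∀ j, WreathSym (weightedAut (Δ j) (w j)) (k j))
    (a : Σ q : (Σ j, Fin (k j)), W q.1) :
    wreathAct (F * F') a = wreathAct F (wreathAct F' a) := by
  obtain ⟨⟨j, s⟩, u⟩ := a
  -- Permutations act on tuples by precomposition with the inverse; since `wreathAct` indexes the
  -- tuple by the target copy, this inverse cancels.
  have h : ((mulAutArrow (F j).right) (F' j).left : Fin (k j) → weightedAut (Δ j) (w j))
      ((F j).right ((F' j).right s)) = (F' j).left ((F' j).right s) := by
    change (F' j).left ((F j).right⁻¹ ((F j).right ((F' j).right s))) = _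
    simp
  simp only [wreathAct, Pi.mul_apply, SemidirectProduct.mul_right, SemidirectProduct.mul_left,
    Equiv.Perm.mul_apply]
  rw [h]
  rfl

theorem wreathAct_one (a : Σ q : (Σ j, Fin (k j)), W q.1) :
    wreathAct (1 : ∀ j, WreathSym (weightedAut (Δ j) (w j)) (k j)) a = a := rfl

theorem copiesGraph_adj_wreathAct (F : ∀ j, WreathSym (weightedAut (Δ j) (w j)) (k j))
    {a b : Σ q : (Σ j, Fin (k j)), W q.1} (h : (copiesGraph Δ k).Adj a b) :
    (copiesGraph Δ k).Adj (wreathAct F a) (wreathAct F b) := by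
  obtain ⟨⟨j, s⟩, u, v, rfl, rfl, h⟩ := h
  exact ⟨⟨j, (F j).right s⟩, _, _, rfl, rfl, ((F j).left ((F j).right s)).1.map_rel_iff.2 h⟩

/-- The action of a family of elements of wreath products, as an automorphism. -/
def wreathIso (F : ∀ j, WreathSym (weightedAut (Δ j) (w j)) (k j)) :
    copiesGraph Δ k ≃g copiesGraph Δ k where
  toFun := wreathAct F
  invFun := wreathAct F⁻¹
  left_inv a := by rw [← wreathAct_mul, inv_mul_cancel, wreathAct_one]
  right_inv a := by rw [← wreathAct_mul, mul_inv_cancel, wreathAct_one]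
  map_rel_iff' := by
    intro a b
    refine ⟨fun h => ?_, copiesGraph_adj_wreathAct F⟩
    have h' := copiesGraph_adj_wreathAct F⁻¹ h
    change (copiesGraph Δ k).Adj (wreathAct F⁻¹ (wreathAct F a))
      (wreathAct F⁻¹ (wreathAct F b)) at h'
    rwa [← wreathAct_mul, ← wreathAct_mul, inv_mul_cancel, wreathAct_one, wreathAct_one] at h'

/-- The homomorphism from the product of wreath products to the automorphism group. -/
def wreathHom : (∀ j, WreathSym (weightedAut (Δ j) (w j)) (k j)) →*
    weightedAut (copiesGraph Δ k) (copiesWeight w k) where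
  toFun F := ⟨wreathIso F, fun a => ((F a.1.1).left ((F a.1.1).right a.1.2)).2 a.2⟩
  map_one' := by
    ext a : 2
    exact wreathAct_one a
  map_mul' F F' := by
    ext a : 2
    exact wreathAct_mul F F' a

theorem injective_wreathHom [∀ j, Nonempty (W j)] :
    Function.Injective (wreathHom (Δ := Δ) (w := w) (k := k)) := by
  intro F F' h
  have h1 : ∀ j s u, wreathAct F ⟨⟨j, s⟩, u⟩ = wreathAct F' ⟨⟨j, s⟩, u⟩ := fun j s u =>
    congrArg (fun φ => φ.1 ⟨⟨j, s⟩, u⟩) h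
  funext j
  have hr : (F j).right = (F' j).right := by
    ext s : 1
    have := congrArg Sigma.fst (h1 j s (Classical.arbitrary _))
    exact eq_of_heq (Sigma.mk.inj this).2
  refine SemidirectProduct.ext ?_ hr
  funext s
  ext u
  have h2 := h1 j ((F j).right.symm s) u
  unfold wreathAct at h2
  simp only [← hr, Equiv.apply_symm_apply] at h2
  exact eq_of_heq (Sigma.mk.inj h2).2

/-- Dominating vertices force an automorphism to send each copy into one copy, and `hpres` keeps the
type `j`. It therefore amounts to permutations of the copies together with automorphisms of the `Δ
j`. -/
theorem surjective_wreathHom (hub : ∀ j, W j) (hhub : ∀ j, IsDominating (Δ j) (hub j))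
    (hpres : ∀ φ ∈ weightedAut (copiesGraph Δ k) (copiesWeight w k), ∀ a, (φ a).1.1 = a.1.1) :
    Function.Surjective (wreathHom (Δ := Δ) (w := w) (k := k)) := by
  have hex : ∀ φ ∈ weightedAut (copiesGraph Δ k) (copiesWeight w k), ∀ j s, ∃ s', ∀ u, ∃ u',
      φ ⟨⟨j, s⟩, u⟩ = ⟨⟨j, s'⟩, u'⟩ := by
    intro φ hφ j s
    obtain ⟨⟨j', s'⟩, h⟩ := exists_fst_of_sigmaGraph_iso
      (fun q : (Σ j, Fin (k j)) => hub q.1) (fun q => hhub q.1) φ ⟨j, s⟩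
    obtain ⟨u', h'⟩ := h (hub j)
    obtain rfl : j' = j := by
      have := hpres φ hφ ⟨⟨j, s⟩, hub j⟩
      rwa [h'] at this
    exact ⟨s', h⟩
  intro φ
  choose σ hσ using hex φ.1 φ.2
  choose g hg using hσ
  choose σ' hσ' using hex φ⁻¹.1 φ⁻¹.2
  choose g' hg' using hσ'
  have hl : ∀ j s u, (⟨⟨j, σ' j (σ j s)⟩, g' j (σ j s) (g j s u)⟩ :
      Σ q : (Σ j, Fin (k j)), W q.1) = ⟨⟨j, s⟩, u⟩ := by
    intro j s u
    rw [← hg', ← hg]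
    exact RelIso.inv_apply_self φ.1 _
  have hr : ∀ j s u, (⟨⟨j, σ j (σ' j s)⟩, g j (σ' j s) (g' j s u)⟩ :
      Σ q : (Σ j, Fin (k j)), W q.1) = ⟨⟨j, s⟩, u⟩ := by
    intro j s u
    rw [← hg, ← hg']
    exact RelIso.apply_inv_self φ.1 _
  have fstEq : ∀ {j} {s s' : Fin (k j)} {u u' : W j},
      (⟨⟨j, s⟩, u⟩ : Σ q : (Σ j, Fin (k j)), W q.1) = ⟨⟨j, s'⟩, u'⟩ → s = s' := fun h =>
    eq_of_heq (Sigma.mk.inj (congrArg Sigma.fst h)).2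
  have sndEq : ∀ {j} {s s' : Fin (k j)} {u u' : W j},
      (⟨⟨j, s⟩, u⟩ : Σ q : (Σ j, Fin (k j)), W q.1) = ⟨⟨j, s'⟩, u'⟩ → u = u' := fun h => by
    obtain rfl := fstEq h
    exact eq_of_heq (Sigma.mk.inj h).2
  have hσσ' : ∀ j s, σ j (σ' j s) = s := fun j s => fstEq (hr j s (hub j))
  have hσ'σ : ∀ j s, σ' j (σ j s) = s := fun j s => fstEq (hl j s (hub j))
  let τ : ∀ j, Equiv.Perm (Fin (k j)) := fun j => ⟨σ j, σ' j, hσ'σ j, hσσ' j⟩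
  have hgr : ∀ j s u, g j (σ' j s) (g' j s u) = u := fun j s u => sndEq (hr j s u)
  have hgl : ∀ j s u, g' j s (g j (σ' j s) u) = u := fun j s u => by
    have := sndEq (hl j (σ' j s) u)
    rwa [hσσ'] at this
  -- The component at the target copy `s` is read off from `φ` on the source copy `σ' j s`.
  let f : ∀ j, Fin (k j) → weightedAut (Δ j) (w j) := fun j s =>
    ⟨{ toFun := g j (σ' j s)
       invFun := g' j s
       left_inv := hgl j s
       right_inv := hgr j s
       map_rel_iff' := by
        intro u v
        change (Δ j).Adj (g j (σ' j s) u) (g j (σ' j s) v) ↔ _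
        have h := φ.1.map_rel_iff (a := ⟨⟨j, σ' j s⟩, u⟩) (b := ⟨⟨j, σ' j s⟩, v⟩)
        rw [hg, hg, sigmaGraph_adj_mk, sigmaGraph_adj_mk] at h
        exact h }, fun u => by
      have h := φ.2 ⟨⟨j, σ' j s⟩, u⟩
      rw [hg] at h
      exact h⟩
  refine ⟨fun j => ⟨f j, τ j⟩, ?_⟩
  ext a : 2
  obtain ⟨⟨j, s⟩, u⟩ := a
  rw [hg]
  change (⟨⟨j, σ j s⟩, g j (σ' j (σ j s)) u⟩ : Σ q : (Σ j, Fin (k j)), W q.1) = _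
  rw [hσ'σ]

/-- The automorphism group of a disjoint union of copies of connected graphs. -/
theorem nonempty_wreath_mulEquiv (hub : ∀ j, W j) (hhub : ∀ j, IsDominating (Δ j) (hub j))
    (hpres : ∀ φ ∈ weightedAut (copiesGraph Δ k) (copiesWeight w k), ∀ a, (φ a).1.1 = a.1.1) :
    Nonempty ((∀ j, WreathSym (weightedAut (Δ j) (w j)) (k j)) ≃*
      weightedAut (copiesGraph Δ k) (copiesWeight w k)) :=
  haveI : ∀ j, Nonempty (W j) := fun j => ⟨hub j⟩
  ⟨MulEquiv.ofBijective wreathHom ⟨injective_wreathHom, surjective_wreathHom hub hhub hpres⟩⟩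

/-- The automorphism group of the weighted quotient of a disjoint union of copies of connected
graphs of different sizes. -/
theorem nonempty_wreath_mulEquiv_autMen {U : J → Type*} [∀ j, Finite (U j)]
    (Γ : ∀ j, SimpleGraph (U j)) (k : J → ℕ) (hub : ∀ j, U j)
    (hhub : ∀ j, IsDominating (Γ j) (hub j))
    (hcard : Function.Injective fun j => Nat.card (U j)) :
    Nonempty ((∀ j, WreathSym (AutMen (Γ j)) (k j)) ≃* AutMen (copiesGraph Γ k)) := by
  have : ∀ j, Fintype (Quotient (menSetoid (Γ j))) := fun j => Fintype.ofFinite _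
  have hhub' : ∀ j, IsDominating (menQuotient (Γ j)) (menMk (Γ j) (hub j)) := fun j =>
    isDominating_menMk.2 (hhub j)
  obtain ⟨e⟩ := nonempty_wreath_mulEquiv (Δ := fun j => menQuotient (Γ j))
    (w := fun j => menWeight (Γ j)) (k := k) (fun j => menMk (Γ j) (hub j)) hhub' (by
      -- The total weight of a part is its number of vertices, which determines `j` by `hcard`.
      intro φ hφ a
      have h := sum_weight_eq_of_sigmaGraph_iso (w := fun q : (Σ j, Fin (k j)) =>
        menWeight (Γ q.1)) (fun q => menMk (Γ q.1) (hub q.1)) (fun q => hhub' q.1) hφ a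
      rw [sum_menWeight, sum_menWeight] at h
      exact hcard h)
  exact ⟨e.trans (autMenSigma fun q : (Σ j, Fin (k j)) => Γ q.1)⟩

end Wreath

/-! ### Orders and cyclic subgroups -/

section Cyclic

variable {G : Type*} [CommGroup G]

/-- A cyclic group has at most `orderOf v` solutions of `z ^ orderOf v = 1`, and the powers of `v`
already supply that many. -/
theorem mem_zpowers_of_orderOf_dvd {C : Type*} [CommGroup C] [IsCyclic C] [Finite C] {u v : C}
    (h : orderOf u ∣ orderOf v) : u ∈ Subgroup.zpowers v := by
  have h1 : Subgroup.zpowers v ≤ (powMonoidHom (orderOf v) : C →* C).ker := by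
    rw [Subgroup.zpowers_le]
    exact pow_orderOf_eq_one v
  have h2 := Subgroup.eq_of_le_of_card_ge h1 (by
    rw [IsCyclic.card_powMonoidHom_ker, Nat.card_zpowers]
    exact Nat.gcd_le_right _ (orderOf_pos v))
  rw [h2]
  exact orderOf_dvd_iff_pow_eq_one.1 h

theorem mem_zpowers_of_mem_zpowers [Finite G] {g u v : G} (hu : u ∈ Subgroup.zpowers g)
    (hv : v ∈ Subgroup.zpowers g) (h : orderOf u ∣ orderOf v) : u ∈ Subgroup.zpowers v := by
  have h1 : (⟨u, hu⟩ : Subgroup.zpowers g) ∈ Subgroup.zpowers (⟨v, hv⟩ : Subgroup.zpowers g) := by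
    apply mem_zpowers_of_orderOf_dvd
    rwa [← Subgroup.orderOf_coe, ← Subgroup.orderOf_coe]
  obtain ⟨n, hn⟩ := Subgroup.mem_zpowers_iff.1 h1
  exact Subgroup.mem_zpowers_iff.2 ⟨n, congrArg Subtype.val hn⟩

theorem zpowers_eq_of_mem_zpowers [Finite G] {g u v : G} (hu : u ∈ Subgroup.zpowers g)
    (hv : v ∈ Subgroup.zpowers g) (h : orderOf u = orderOf v) :
    Subgroup.zpowers u = Subgroup.zpowers v :=
  le_antisymm (Subgroup.zpowers_le.2 (mem_zpowers_of_mem_zpowers hu hv h.dvd))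
    (Subgroup.zpowers_le.2 (mem_zpowers_of_mem_zpowers hv hu h.symm.dvd))

theorem orderOf_eq_of_zpowers_eq {u v : G} (h : Subgroup.zpowers u = Subgroup.zpowers v) :
    orderOf u = orderOf v := by
  rw [← Nat.card_zpowers, ← Nat.card_zpowers, h]

theorem exists_zpowers_pow_eq [Finite G] {p : ℕ} (hp : p.Prime) (hG : IsPGroup p G) {x v : G}
    (h : x ∈ Subgroup.zpowers v) :
    ∃ k, Subgroup.zpowers (v ^ p ^ k) = Subgroup.zpowers x ∧ orderOf v = p ^ k * orderOf x := by
  have := Fact.mk hp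
  obtain ⟨i, hi⟩ := IsPGroup.iff_orderOf.1 hG x
  obtain ⟨j, hj⟩ := IsPGroup.iff_orderOf.1 hG v
  have hij : i ≤ j := by
    have := orderOf_dvd_of_mem_zpowers h
    rw [hi, hj] at this
    exact (Nat.pow_dvd_pow_iff_le_right hp.one_lt).1 this
  have hmul : p ^ j = p ^ (j - i) * p ^ i := by rw [← pow_add, Nat.sub_add_cancel hij]
  refine ⟨j - i, zpowers_eq_of_mem_zpowers (g := v) (Subgroup.npow_mem_zpowers v _) h ?_, by
    rw [hi, hj, hmul]⟩
  rw [orderOf_pow_of_dvd (pow_ne_zero _ hp.ne_zero) (by rw [hj, hmul]; exact dvd_mul_right _ _),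
    hi, hj, hmul, Nat.mul_div_cancel_left _ (pow_pos hp.pos _)]

theorem orderOf_eq_mul_of_orderOf_pow {p n : ℕ} (hp : p.Prime) {g : G}
    (h : orderOf (g ^ p) = n) (hn : p ∣ n) : orderOf g = p * n := by
  have hd : p ∣ orderOf g := hn.trans (h ▸ orderOf_pow_dvd p)
  rw [orderOf_pow_of_dvd hp.ne_zero hd] at h
  rw [← h, Nat.mul_div_cancel' hd]

end Cyclic

/-! ### Cones in the power graph -/

section Cone

variable {G : Type*} [Group G]

/-- The nontrivial elements having `x` as a power. -/
def coneSet (x : G) : Set {g : G // g ≠ 1} := {v | x ∈ Subgroup.zpowers (v : G)}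

/-- The subgraph of the power graph induced on the elements having `x` as a power. -/
def coneBase (x : G) : SimpleGraph (coneSet x) := (powerGraph G).induce (coneSet x)

theorem exists_pos_pow_iff [Finite G] {x y : G} :
    (∃ m : ℕ, 0 < m ∧ y = x ^ m) ↔ y ∈ Subgroup.zpowers x := by
  constructor
  · rintro ⟨m, -, rfl⟩
    exact Subgroup.npow_mem_zpowers x m
  · intro h
    obtain ⟨m, hm⟩ := (mem_powers_iff_mem_zpowers.2 h : y ∈ Submonoid.powers x)
    refine ⟨m + orderOf x, Nat.add_pos_right _ (orderOf_pos x), ?_⟩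
    rw [pow_add, pow_orderOf_eq_one, mul_one]
    exact hm.symm

theorem powerGraph_adj_iff [Finite G] {u v : {g : G // g ≠ 1}} : (powerGraph G).Adj u v ↔
    u ≠ v ∧ ((v : G) ∈ Subgroup.zpowers (u : G) ∨ (u : G) ∈ Subgroup.zpowers (v : G)) :=
  and_congr Iff.rfl (or_congr exists_pos_pow_iff exists_pos_pow_iff)

theorem mem_nbhd_iff [Finite G] {x g : G} (hx : x ≠ 1) : g ∈ nbhd x ↔
    g ≠ 1 ∧ g ≠ x ∧ (g ∈ Subgroup.zpowers x ∨ x ∈ Subgroup.zpowers g) := by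
  constructor
  · rintro ⟨_, hg, h⟩
    obtain ⟨h1, h2⟩ := powerGraph_adj_iff.1 h
    exact ⟨hg, fun h => h1 (Subtype.ext h.symm), h2⟩
  · rintro ⟨hg, h1, h2⟩
    exact ⟨hx, hg, powerGraph_adj_iff.2 ⟨fun h => h1 (congrArg Subtype.val h).symm, h2⟩⟩

theorem mem_hatSet_iff [Finite G] {x : G} (hx : x ≠ 1) {v : {g : G // g ≠ 1}} :
    v ∈ hatSet x ↔ x ∈ Subgroup.zpowers (v : G) ∧ (v : G) ∉ Subgroup.zpowers x := by
  change (v : G) ∈ nbhd x ∧ _ ↔ _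
  rw [mem_nbhd_iff hx]
  constructor
  · rintro ⟨⟨-, -, h1 | h1⟩, h2⟩
    · exact absurd h1 h2
    · exact ⟨h1, h2⟩
  · rintro ⟨h1, h2⟩
    exact ⟨⟨v.2, fun h => h2 (h ▸ Subgroup.mem_zpowers x), Or.inr h1⟩, h2⟩

theorem isDominating_coneBase [Finite G] {x : G} (v : coneSet x)
    (hv : (v : G) ∈ Subgroup.zpowers x) : IsDominating (coneBase x) v := by
  intro u hu
  exact powerGraph_adj_iff.2 ⟨fun h => hu (Subtype.ext h.symm),
    Or.inr (Subgroup.zpowers_le.2 u.2 hv)⟩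

/-- The cone exceeds `hatSet x` only by the generators of `⟨x⟩`, and these dominate it. -/
theorem nonempty_autMen_coneBase_mulEquiv_autHat [Finite G] {x : G} (hx : x ≠ 1) :
    Nonempty (AutMen (coneBase x) ≃* AutHat x) := by
  let f : hatBase x ↪g coneBase x :=
    { toFun := fun v => ⟨v.1, ((mem_hatSet_iff hx).1 v.2).1⟩
      inj' := fun u v h => Subtype.ext (congrArg (fun z : coneSet x => z.1) h)
      map_rel_iff' := Iff.rfl }
  obtain ⟨e⟩ := nonempty_autMen_mulEquiv_of_isDominating f (by
    intro v hv
    apply isDominating_coneBase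
    by_contra h
    exact hv ⟨⟨v.1, (mem_hatSet_iff hx).2 ⟨v.2, h⟩⟩, rfl⟩)
  exact ⟨e.symm⟩

/-- The cone of `x` and the cone of its image under an injective homomorphism whose range contains
the latter cone are isomorphic. -/
theorem nonempty_coneBase_iso {H : Type*} [Group H] (f : H →* G) (hf : Function.Injective f)
    (x : H) (hx : ∀ g : G, f x ∈ Subgroup.zpowers g → g ∈ f.range) :
    Nonempty (coneBase x ≃g coneBase (f x)) := by
  have hmem : ∀ u v : H, f u ∈ Subgroup.zpowers (f v) ↔ u ∈ Subgroup.zpowers v := by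
    intro u v
    rw [← MonoidHom.map_zpowers, Subgroup.mem_map_iff_mem hf]
  let g : coneSet x → coneSet (f x) := fun v =>
    ⟨⟨f v.1.1, (map_ne_one_iff f hf).2 v.1.2⟩, (hmem _ _).2 v.2⟩
  have hg : Function.Bijective g := by
    constructor
    · intro u v h
      exact Subtype.ext (Subtype.ext (hf (congrArg (fun z : coneSet (f x) => (z.1 : G)) h)))
    · rintro ⟨⟨v, hv1⟩, hv⟩
      obtain ⟨u, rfl⟩ := hx v hv
      exact ⟨⟨⟨u, (map_ne_one_iff f hf).1 hv1⟩, (hmem _ _).1 hv⟩, rfl⟩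
  have hpow : ∀ u v : H, (∃ m : ℕ, 0 < m ∧ f u = f v ^ m) ↔ ∃ m : ℕ, 0 < m ∧ u = v ^ m := by
    intro u v
    simp only [← map_pow, hf.eq_iff]
  refine ⟨⟨Equiv.ofBijective g hg, ?_⟩⟩
  intro u v
  refine and_congr (not_congr ?_) (or_congr (hpow _ _) (hpow _ _))
  exact Subtype.ext_iff.trans ((hf.eq_iff (a := u.1.1) (b := v.1.1)).trans Subtype.ext_iff.symm)

/-- The graph `hatBase b` is the disjoint union of the cones of suitable representatives of the
minimal cyclic subgroups above `b`. -/
theorem nonempty_sigmaGraph_coneBase_iso [Finite G] {b : G} {Y : Type*} (g : Y → G)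
    (h1 : ∀ y (v : {g : G // g ≠ 1}), g y ∈ Subgroup.zpowers (v : G) → v ∈ hatSet b)
    (h2 : ∀ v ∈ hatSet b, ∃ y, g y ∈ Subgroup.zpowers (v : G))
    (h3 : ∀ y y' (v : G), g y ∈ Subgroup.zpowers v → g y' ∈ Subgroup.zpowers v → y = y') :
    Nonempty (sigmaGraph (fun y => coneBase (g y)) ≃g hatBase b) := by
  let F : (Σ y, coneSet (g y)) → hatSet b := fun a => ⟨a.2.1, h1 a.1 _ a.2.2⟩
  have hF : Function.Bijective F := by
    constructor
    · rintro ⟨y, u, hu⟩ ⟨y', v, hv⟩ h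
      obtain rfl : u = v := congrArg Subtype.val h
      obtain rfl := h3 y y' _ hu hv
      rfl
    · rintro ⟨v, hv⟩
      obtain ⟨y, hy⟩ := h2 v hv
      exact ⟨⟨y, v, hy⟩, rfl⟩
  refine ⟨⟨Equiv.ofBijective F hF, ?_⟩⟩
  rintro ⟨y, u, hu⟩ ⟨y', v, hv⟩
  change (powerGraph G).Adj u v ↔ _
  by_cases hy : y = y'
  · subst hy
    exact (sigmaGraph_adj_mk (Γ := fun y => coneBase (g y)) (u := ⟨u, hu⟩) (v := ⟨v, hv⟩)).symm
  · refine iff_of_false (fun h => hy ?_) (fun h => hy (fst_eq_of_sigmaGraph_adj h))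
    -- Of two adjacent elements one is a power of the other, so the larger cyclic group contains
    -- both representatives.
    rcases (powerGraph_adj_iff.1 h).2 with h | h
    · exact h3 y y' _ hu (Subgroup.zpowers_le.2 h hv)
    · exact h3 y y' _ (Subgroup.zpowers_le.2 h hu) hv

end Cone

/-! ### The size of a cone determines the height of its apex -/

section Card

variable {G : Type*} [CommGroup G] [Finite G]

theorem card_generators (x : G) :
    Nat.card {u : G // Subgroup.zpowers u = Subgroup.zpowers x} = (orderOf x).totient := by
  classical
  have := Fintype.ofFinite (Subgroup.zpowers x)
  rw [← IsCyclic.card_orderOf_eq_totient (α := Subgroup.zpowers x) (d := orderOf x)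
    (by rw [← Nat.card_eq_fintype_card, Nat.card_zpowers]), ← Fintype.card_subtype,
    ← Nat.card_eq_fintype_card]
  refine Nat.card_congr
    ⟨fun u => ⟨⟨u, u.2.le (Subgroup.mem_zpowers u.1)⟩, ?_⟩, fun u => ⟨u.1.1, ?_⟩,
      fun _ => rfl, fun _ => rfl⟩
  · rw [← Subgroup.orderOf_coe]
    exact orderOf_eq_of_zpowers_eq u.2
  · refine zpowers_eq_of_mem_zpowers u.1.2 (Subgroup.mem_zpowers x) ?_
    rw [Subgroup.orderOf_coe]
    exact u.2

/-- Sort the cone by the exponent `k` with `⟨v ^ p ^ k⟩ = ⟨x⟩`. For `k ≤ n` each of the `φ(o(x))`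
generators of `⟨x⟩` has a `p ^ k`-th root, and its roots form a coset of `Ω_k`; for `k > n` there
are none. -/
theorem card_coneSet {p n : ℕ} (hp : p.Prime) (hG : IsPGroup p G) {x : G} (hx : x ≠ 1)
    (h : HasHeight p x n) : Nat.card (coneSet x) =
      (orderOf x).totient * ∑ k ∈ Finset.range (n + 1), Nat.card (Omega p k G) := by
  -- The exponent `k` is unique, because a further `p`-th power strictly lowers the order.
  have hdisj : ∀ {k l : ℕ} {v : G}, Subgroup.zpowers (v ^ p ^ k) = Subgroup.zpowers x →
      Subgroup.zpowers (v ^ p ^ l) = Subgroup.zpowers x → k ≤ l := by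
    intro k l v hk hl
    by_contra hlt
    push Not at hlt
    obtain ⟨d, rfl⟩ := Nat.exists_eq_add_of_lt hlt
    have h1 : orderOf ((v ^ p ^ l) ^ p ^ (d + 1)) = orderOf x := by
      rw [← pow_mul, ← pow_add]
      exact orderOf_eq_of_zpowers_eq hk
    have h2 := orderOf_eq_of_zpowers_eq hl
    have h3 : p ∣ orderOf x := (have := Fact.mk hp; hG.dvd_orderOf hx)
    have h4 : orderOf ((v ^ p ^ l) ^ p) < orderOf x := by
      rw [orderOf_pow_of_dvd hp.ne_zero (h2.symm ▸ h3), h2]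
      exact Nat.div_lt_self (orderOf_pos x) hp.one_lt
    have h5 := Nat.le_of_dvd (orderOf_pos _)
      (orderOf_pow_dvd (x := (v ^ p ^ l) ^ p) (p ^ d))
    rw [← pow_mul, ← pow_succ', h1] at h5
    omega
  let A : ℕ → Type _ := fun k => {v : G // Subgroup.zpowers (v ^ p ^ k) = Subgroup.zpowers x}
  let F : (Σ k : Fin (n + 1), A k) → coneSet x := fun a =>
    ⟨⟨a.2.1, fun h1 => hx (Subgroup.zpowers_eq_bot.1 (by rw [← a.2.2, h1]; simp))⟩, by
      have : x ∈ Subgroup.zpowers (a.2.1 ^ p ^ (a.1 : ℕ)) := a.2.2.ge (Subgroup.mem_zpowers x)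
      exact Subgroup.zpowers_le.2 (Subgroup.npow_mem_zpowers _ _) this⟩
  have hF : Function.Bijective F := by
    constructor
    · rintro ⟨k, u, hu⟩ ⟨l, v, hv⟩ h
      obtain rfl : u = v := congrArg (fun z : coneSet x => (z.1 : G)) h
      obtain rfl : k = l := Fin.ext (le_antisymm (hdisj hu hv) (hdisj hv hu))
      rfl
    · rintro ⟨⟨v, hv1⟩, hv⟩
      obtain ⟨k, hk, -⟩ := exists_zpowers_pow_eq hp hG hv
      have hkn : k ≤ n := by
        apply h.2
        obtain ⟨m, hm⟩ := Subgroup.mem_zpowers_iff.1 (hk.ge (Subgroup.mem_zpowers x))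
        exact ⟨v ^ m, by rw [← hm, ← zpow_natCast, ← zpow_natCast, zpow_comm]⟩
      exact ⟨⟨⟨k, Nat.lt_succ_of_le hkn⟩, v, hk⟩, rfl⟩
  have hA : ∀ k ≤ n, Nat.card (A k) = (orderOf x).totient * Nat.card (Omega p k G) := by
    intro k hk
    let B := {u : G // Subgroup.zpowers u = Subgroup.zpowers x}
    have e : A k ≃ Σ u : B, {v : G // v ^ p ^ k = u} :=
      { toFun := fun v => ⟨⟨v.1 ^ p ^ k, v.2⟩, v.1, rfl⟩
        invFun := fun a => ⟨a.2.1, by rw [a.2.2]; exact a.1.2⟩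
        left_inv := fun _ => rfl
        right_inv := by
          rintro ⟨⟨u, hu⟩, v, hv⟩
          obtain rfl : v ^ p ^ k = u := hv
          rfl }
    have := Fintype.ofFinite B
    have hB : ∀ u : B, Nat.card {v : G // v ^ p ^ k = u} = Nat.card (Omega p k G) := by
      rintro ⟨u, hu⟩
      obtain ⟨z, hz⟩ : ∃ z : G, z ^ p ^ k = u := by
        obtain ⟨y, hy⟩ := h.1
        obtain ⟨m, hm⟩ := Subgroup.mem_zpowers_iff.1 (hu.le (Subgroup.mem_zpowers u))
        refine ⟨(y ^ p ^ (n - k)) ^ m, ?_⟩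
        rw [← hm, ← hy, ← zpow_natCast, zpow_comm, zpow_natCast, ← pow_mul, ← pow_add,
          Nat.sub_add_cancel hk]
      refine Nat.card_congr ⟨fun v => ⟨v.1 / z, ?_⟩, fun v => ⟨v.1 * z, ?_⟩, fun v => ?_,
        fun v => ?_⟩
      · change (v.1 / z) ^ p ^ k = 1
        rw [div_pow, v.2, hz, div_self']
      · have : v.1 ^ p ^ k = 1 := v.2
        rw [mul_pow, this, hz, one_mul]
      · simp
      · simp
    rw [Nat.card_congr e, Nat.card_sigma, Finset.sum_congr rfl fun u _ => hB u,
      Finset.sum_const, Finset.card_univ, ← Nat.card_eq_fintype_card, card_generators, smul_eq_mul]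
  rw [← Nat.card_congr (Equiv.ofBijective F hF), Nat.card_sigma, Finset.sum_congr rfl
    fun k _ => hA _ (Nat.le_of_lt_succ k.2), ← Finset.mul_sum,
    Fin.sum_univ_eq_sum_range (fun k => Nat.card (Omega p k G))]

/-- Each `Ω_k` is nonempty, so the sum in `card_coneSet` is strictly increasing in the height. -/
theorem height_eq_of_card_coneSet_eq {p n n' : ℕ} (hp : p.Prime) (hG : IsPGroup p G) {x x' : G}
    (hx : x ≠ 1) (ho : orderOf x = orderOf x') (h : HasHeight p x n) (h' : HasHeight p x' n')
    (hc : Nat.card (coneSet x) = Nat.card (coneSet x')) : n = n' := by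
  have hx' : x' ≠ 1 := by
    rintro rfl
    rw [orderOf_one, orderOf_eq_one_iff] at ho
    exact hx ho
  rw [card_coneSet hp hG hx h, card_coneSet hp hG hx' h', ho,
    Nat.mul_right_inj (Nat.totient_pos.2 (orderOf_pos x')).ne'] at hc
  have hmono : StrictMono fun n => ∑ k ∈ Finset.range n, Nat.card (Omega p k G) := by
    refine strictMono_nat_of_lt_succ fun n => ?_
    rw [Finset.sum_range_succ]
    exact Nat.lt_add_of_pos_right Nat.card_pos
  exact Nat.succ_injective (hmono.injective hc)

end Card

/-! ### Elements of order dividing `p` in cyclic `p`-groups -/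

section ZModPow

variable {p : ℕ}

/-- Additively, an element killed by `p` is a multiple of `p ^ (n - 1)`, hence of `p ^ k` for `k <
n`, while `p ^ k` acts as zero for `k ≥ n`. -/
theorem exists_pow_eq_iff_of_pow_eq_one (hp : p.Prime) {n : ℕ} (hn : 0 < n) (k : ℕ)
    {z : Multiplicative (ZMod (p ^ n))} (hz : z ^ p = 1) :
    (∃ w, w ^ p ^ k = z) ↔ (n ≤ k → z = 1) := by
  have := NeZero.mk (pow_ne_zero n hp.ne_zero)
  constructor
  · rintro ⟨w, rfl⟩ hk
    obtain ⟨d, rfl⟩ := Nat.exists_eq_add_of_le hk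
    apply Multiplicative.toAdd.injective
    rw [toAdd_pow, toAdd_one, nsmul_eq_mul, pow_add, Nat.cast_mul, ZMod.natCast_self, zero_mul,
      zero_mul]
  · intro h
    rcases le_or_gt n k with hk | hk
    · exact ⟨1, by rw [one_pow, h hk]⟩
    · have h1 : p ^ n ∣ p * z.toAdd.val := by
        rw [← ZMod.natCast_eq_zero_iff, Nat.cast_mul, ZMod.natCast_zmod_val, ← nsmul_eq_mul,
          ← toAdd_pow, hz, toAdd_one]
      obtain ⟨d, rfl⟩ := Nat.exists_eq_add_of_lt hk
      have h2 : p ^ (k + d) ∣ z.toAdd.val := by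
        refine (Nat.mul_dvd_mul_iff_left hp.pos).1 (dvd_trans (dvd_of_eq ?_) h1)
        ring
      obtain ⟨q, hq⟩ := (pow_dvd_pow p (Nat.le_add_right k d)).trans h2
      refine ⟨Multiplicative.ofAdd (q : ZMod _), ?_⟩
      apply Multiplicative.toAdd.injective
      rw [toAdd_pow, toAdd_ofAdd, nsmul_eq_mul, ← Nat.cast_mul, ← hq, ZMod.natCast_zmod_val]

theorem isUnit_of_pow_mul_ne_zero (hp : p.Prime) {k : ℕ} {α : ZMod (p ^ (k + 1))}
    (h : (p : ZMod (p ^ (k + 1))) ^ k * α ≠ 0) : IsUnit α := by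
  have := NeZero.mk (pow_ne_zero (k + 1) hp.ne_zero)
  rw [← ZMod.natCast_zmod_val α, ZMod.isUnit_iff_coprime]
  refine Nat.Coprime.pow_right _ (Nat.Coprime.symm ((Nat.Prime.coprime_iff_not_dvd hp).2 ?_))
  rintro ⟨q, hq⟩
  apply h
  rw [← ZMod.natCast_zmod_val α, hq, Nat.cast_mul, ← mul_assoc, ← pow_succ, ← Nat.cast_pow,
    ZMod.natCast_self, zero_mul]

theorem card_pow_eq_one_zmod {n : ℕ} (hp : p.Prime) (hn : 0 < n) :
    Nat.card {z : Multiplicative (ZMod (p ^ n)) // z ^ p = 1} = p := by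
  have := NeZero.mk (pow_ne_zero n hp.ne_zero)
  have h := IsCyclic.card_powMonoidHom_ker (Multiplicative (ZMod (p ^ n))) p
  rw [Nat.card_congr Multiplicative.toAdd, Nat.card_zmod,
    Nat.gcd_eq_right (dvd_pow_self p hn.ne')] at h
  exact h

end ZModPow

/-! ### Transvections -/

section Transvection

variable {A : Type*} [CommGroup A] [Finite A]

/-- The transvection along an element `g` given by a homomorphism to a finite cyclic group. -/
theorem exists_transvection {N : ℕ} [NeZero N] (χ : A →* Multiplicative (ZMod N)) {g : A}
    (hg : g ^ N = 1) (hu : IsUnit (1 + (χ g).toAdd)) :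
    ∃ T : A ≃* A, ∀ v, T v = v * g ^ (χ v).toAdd.val := by
  let f : A →* A :=
    { toFun := fun v => v * g ^ (χ v).toAdd.val
      map_one' := by simp
      map_mul' := fun u v => by
        rw [map_mul, toAdd_mul, ZMod.val_add, ← pow_eq_pow_mod _ hg, pow_add]
        exact mul_mul_mul_comm _ _ _ _ }
  have hf : Function.Injective f := by
    rw [injective_iff_map_eq_one]
    intro v hv
    change v * g ^ (χ v).toAdd.val = 1 at hv
    -- Applying `χ` to the kernel equation gives `χ v · (1 + χ g) = 0` additively, so `χ v` vanishes
    -- and then `v = 1`.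
    have h1 := congrArg (fun z => (χ z).toAdd) hv
    simp only [map_mul, map_pow, toAdd_mul, toAdd_pow, nsmul_eq_mul, ZMod.natCast_zmod_val,
      map_one, toAdd_one] at h1
    have h2 : (χ v).toAdd = 0 := by
      rw [← hu.mul_left_eq_zero, mul_add, mul_one, h1]
    rwa [h2, ZMod.val_zero, pow_zero, mul_one] at hv
  exact ⟨MulEquiv.ofBijective f (Finite.injective_iff_bijective.1 hf), fun _ => rfl⟩

end Transvection

/-! ### Heights in coordinates and transitivity of automorphisms -/

section Coordinates

variable {A : Type*} [CommGroup A] {p : ℕ} {ι : Type*} {n : ι → ℕ}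

theorem exists_pow_eq_iff_coordinates
    (E : A ≃* ∀ s : ι, Multiplicative (ZMod (p ^ n s))) (hp : p.Prime) (hn : ∀ s, 0 < n s) (k : ℕ) {y : A}
    (hy : y ^ p = 1) : (∃ w, w ^ p ^ k = y) ↔ ∀ s, n s ≤ k → E y s = 1 := by
  have hy' : ∀ s, E y s ^ p = 1 := fun s => by
    rw [← Pi.pow_apply, ← map_pow, hy, map_one, Pi.one_apply]
  have key : (∃ w, w ^ p ^ k = y) ↔ ∀ s, ∃ w, w ^ p ^ k = E y s := by
    constructor
    · rintro ⟨w, rfl⟩ s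
      exact ⟨E w s, by rw [map_pow, Pi.pow_apply]⟩
    · intro h
      choose w hw using h
      refine ⟨E.symm w, E.injective ?_⟩
      rw [map_pow, MulEquiv.apply_symm_apply]
      exact funext hw
  rw [key]
  exact forall_congr' fun s => exists_pow_eq_iff_of_pow_eq_one hp (hn s) k (hy' s)

/-- Having a `p ^ k`-th root kills the coordinates with `n s ≤ k`; having no `p ^ (k + 1)`-th root
leaves a nontrivial one with `n s ≤ k + 1`. -/
theorem exists_coordinate_of_hasHeight
    (E : A ≃* ∀ s : ι, Multiplicative (ZMod (p ^ n s))) (hp : p.Prime) (hn : ∀ s, 0 < n s) {k : ℕ} {y : A}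
    (hy : y ^ p = 1) (h : HasHeight p y k) : ∃ s, n s = k + 1 ∧ E y s ≠ 1 := by
  have h1 := (exists_pow_eq_iff_coordinates E hp hn k hy).1 h.1
  have h2 : ¬ ∃ w, w ^ p ^ (k + 1) = y := fun h' => absurd (h.2 h') (by simp)
  rw [exists_pow_eq_iff_coordinates E hp hn (k + 1) hy] at h2
  push Not at h2
  obtain ⟨s, hs, hs'⟩ := h2
  refine ⟨s, le_antisymm hs (Nat.succ_le_of_lt (lt_of_not_ge fun h => hs' (h1 s h))), hs'⟩

theorem exists_hasHeight_of_coordinate [DecidableEq ι]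
    (E : A ≃* ∀ s : ι, Multiplicative (ZMod (p ^ n s))) (hp : p.Prime) (hn : ∀ s, 0 < n s) {k : ℕ}
    {s : ι} (hs : n s = k + 1) : ∃ y : A, orderOf y = p ∧ HasHeight p y k := by
  have := Fact.mk hp
  have := NeZero.mk (pow_ne_zero (n s) hp.ne_zero)
  obtain ⟨z, hz⟩ := exists_prime_orderOf_dvd_card' (G := Multiplicative (ZMod (p ^ n s))) p (by
    rw [Nat.card_congr Multiplicative.toAdd, Nat.card_zmod]
    exact dvd_pow_self p (hn s).ne')
  have ho : orderOf (E.symm (Pi.mulSingle s z)) = p := by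
    rw [MulEquiv.orderOf_eq, orderOf_piMulSingle, hz]
  have hy : E.symm (Pi.mulSingle s z) ^ p = 1 := orderOf_dvd_iff_pow_eq_one.1 ho.dvd
  have hz1 : z ≠ 1 := by
    rintro rfl
    rw [orderOf_one] at hz
    exact hp.one_lt.ne hz
  refine ⟨_, ho, (exists_pow_eq_iff_coordinates E hp hn k hy).2 fun s' hs' => ?_, fun l hl => ?_⟩
  · have : s' ≠ s := by
      rintro rfl
      omega
    rw [MulEquiv.apply_symm_apply, Pi.mulSingle_eq_of_ne this]
  · by_contra hlt
    refine hz1 ?_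
    have := (exists_pow_eq_iff_coordinates E hp hn l hy).1 hl s (by omega)
    rwa [MulEquiv.apply_symm_apply, Pi.mulSingle_eq_same] at this

/-- Take coordinate projections that detect `y` and `y'` respectively. If neither detects both
elements, their product does. -/
theorem exists_character_of_hasHeight
    (E : A ≃* ∀ s : ι, Multiplicative (ZMod (p ^ n s))) (hp : p.Prime) (hn : ∀ s, 0 < n s) {k : ℕ} {y y' : A}
    (hy : y ^ p = 1) (h : HasHeight p y k) (hy' : y' ^ p = 1) (h' : HasHeight p y' k) :
    ∃ χ : A →* Multiplicative (ZMod (p ^ (k + 1))), χ y ≠ 1 ∧ χ y' ≠ 1 := by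
  have hχ : ∀ s, n s = k + 1 → ∃ χ : A →* Multiplicative (ZMod (p ^ (k + 1))),
      ∀ v, χ v = 1 ↔ E v s = 1 := by
    intro s hs
    rw [← hs]
    exact ⟨(Pi.evalMonoidHom _ s).comp E.toMonoidHom, fun v => Iff.rfl⟩
  obtain ⟨s, hs, hsy⟩ := exists_coordinate_of_hasHeight E hp hn hy h
  obtain ⟨s', hs', hsy'⟩ := exists_coordinate_of_hasHeight E hp hn hy' h'
  obtain ⟨χ, h1⟩ := hχ s hs
  obtain ⟨χ', h2⟩ := hχ s' hs'
  rw [Ne, ← h1] at hsy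
  rw [Ne, ← h2] at hsy'
  by_cases ha : χ y' = 1
  · by_cases hb : χ' y = 1
    · exact ⟨χ * χ', by simpa [hb] using hsy, by simpa [ha] using hsy'⟩
    · exact ⟨χ', hb, hsy'⟩
  · exact ⟨χ, hsy, ha⟩

/-- Elements of order `p` and of the same height are conjugate under automorphisms. -/
theorem exists_mulEquiv_of_hasHeight [Finite A]
    (E : A ≃* ∀ s : ι, Multiplicative (ZMod (p ^ n s))) (hp : p.Prime) (hn : ∀ s, 0 < n s) {k : ℕ}
    {y y' : A} (hy : y ^ p = 1) (h : HasHeight p y k) (hy' : y' ^ p = 1)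
    (h' : HasHeight p y' k) : ∃ T : A ≃* A, T y = y' := by
  have := NeZero.mk (pow_ne_zero (k + 1) hp.ne_zero)
  obtain ⟨χ, h1, h2⟩ := exists_character_of_hasHeight E hp hn hy h hy' h'
  obtain ⟨z, hz⟩ := h.1
  obtain ⟨z', hz'⟩ := h'.1
  have hunit : ∀ u : A, χ (u ^ p ^ k) ≠ 1 → IsUnit (χ u).toAdd := by
    intro u hu
    refine isUnit_of_pow_mul_ne_zero hp fun h0 => hu ?_
    apply Multiplicative.toAdd.injective
    rw [map_pow, toAdd_pow, nsmul_eq_mul, Nat.cast_pow, h0, toAdd_one]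
  obtain ⟨α, hα⟩ := hunit z (by rwa [hz])
  obtain ⟨β, hβ⟩ := hunit z' (by rwa [hz'])
  have hpow : ∀ u : A, (u ^ p ^ k) ^ p = 1 → u ^ p ^ (k + 1) = 1 := by
    intro u hu
    rwa [pow_succ, pow_mul]
  -- With `m` inverse to `α = χ z`, the transvection along `g = (z' z⁻¹) ^ m` sends `z` to `z · (z'
  -- z⁻¹) = z'`, and `1 + χ g = α⁻¹ β` is a unit.
  let m : ℕ := (↑α⁻¹ : ZMod (p ^ (k + 1))).val
  have hm : (m : ZMod (p ^ (k + 1))) = ↑α⁻¹ := ZMod.natCast_zmod_val _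
  have hgN : (z' * z⁻¹) ^ p ^ (k + 1) = 1 := by
    rw [mul_pow, inv_pow, hpow z' (by rw [hz', hy']), hpow z (by rw [hz, hy]), inv_one, mul_one]
  obtain ⟨T, hT⟩ := exists_transvection χ (g := (z' * z⁻¹) ^ m)
    (by rw [pow_right_comm, hgN, one_pow]) (by
      have : 1 + (χ ((z' * z⁻¹) ^ m)).toAdd = ↑(α⁻¹ * β) := by
        simp only [map_pow, map_mul, map_inv, toAdd_pow, toAdd_mul, toAdd_inv, nsmul_eq_mul, hm,
          ← hα, ← hβ, Units.val_mul, mul_add, mul_neg, Units.inv_mul]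
        ring
      rw [this]
      exact Units.isUnit _)
  refine ⟨T, ?_⟩
  have hTz : T z = z' := by
    have h3 : (z' * z⁻¹) ^ (m * (χ z).toAdd.val) = z' * z⁻¹ := by
      conv_rhs => rw [← pow_one (z' * z⁻¹)]
      have h4 : m * (χ z).toAdd.val ≡ 1 [MOD p ^ (k + 1)] := by
        rw [← ZMod.natCast_eq_natCast_iff, Nat.cast_mul, hm, ZMod.natCast_zmod_val, ← hα,
          Units.inv_mul, Nat.cast_one]
      exact pow_eq_pow_iff_modEq.2 (h4.of_dvd (orderOf_dvd_of_pow_eq_one hgN))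
    rw [hT, ← pow_mul, h3, mul_comm, inv_mul_cancel_right]
  rw [← hz, map_pow, hTz, hz']

/-- Coordinatewise there are `p` choices if `k < n s`, and only the trivial one otherwise. -/
theorem card_pow_eq_one_and_exists_pow [Fintype ι]
    (E : A ≃* ∀ s : ι, Multiplicative (ZMod (p ^ n s))) (hp : p.Prime) (hn : ∀ s, 0 < n s) (k : ℕ) :
    Nat.card {y : A // y ^ p = 1 ∧ ∃ w, w ^ p ^ k = y} =
      p ^ Nat.card {s : ι // k < n s} := by
  classical
  let P : ∀ s, Multiplicative (ZMod (p ^ n s)) → Prop := fun s z => z ^ p = 1 ∧ (n s ≤ k → z = 1)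
  have hP : ∀ s, Nat.card {z // P s z} = if k < n s then p else 1 := by
    intro s
    split_ifs with hs
    · refine Eq.trans (Nat.card_congr (Equiv.subtypeEquivRight fun z => ?_))
        (card_pow_eq_one_zmod hp (hn s))
      exact and_iff_left fun h => absurd hs (not_lt.2 h)
    · rw [Nat.card_eq_one_iff_unique]
      exact ⟨⟨fun u v => Subtype.ext ((u.2.2 (not_lt.1 hs)).trans (v.2.2 (not_lt.1 hs)).symm)⟩,
        ⟨⟨1, one_pow p, fun _ => rfl⟩⟩⟩
  have e : {y : A // y ^ p = 1 ∧ ∃ w, w ^ p ^ k = y} ≃ ∀ s, {z // P s z} := by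
    refine (E.toEquiv.subtypeEquiv (q := fun f => ∀ s, P s (f s)) fun y => ?_).trans
      Equiv.subtypePiEquivPi
    have h1 : y ^ p = 1 ↔ ∀ s, E y s ^ p = 1 := by
      rw [← E.injective.eq_iff, map_pow, map_one, funext_iff]
      rfl
    rw [forall_and]
    change y ^ p = 1 ∧ _ ↔ (∀ s, E y s ^ p = 1) ∧ _
    rw [← h1]
    exact and_congr_right fun hy => exists_pow_eq_iff_coordinates E hp hn k hy
  rw [Nat.card_congr e, Nat.card_pi, Finset.prod_congr rfl fun s _ => hP s, Finset.prod_ite,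
    Finset.prod_const, Finset.prod_const_one, mul_one, Nat.card_eq_fintype_card,
    Fintype.card_subtype]

end Coordinates

/-! ### The subgroup generated by the neighbourhood of `b` -/

section Neighbourhood

variable {G : Type*} [CommGroup G] [Finite G] {p : ℕ} {b : G} {t : ℕ}

/-- Some `v ^ p ^ k` generates `⟨b⟩`, so `b` has a `p ^ k`-th root, and the height bounds `k` by
`t`. -/
theorem pow_mem_zpowers_of_mem_zpowers (hp : p.Prime) (hG : IsPGroup p G)
    (hbt : HasHeight p b t) {v : G} (hv : b ∈ Subgroup.zpowers v) :
    v ^ p ^ t ∈ Subgroup.zpowers b := by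
  obtain ⟨k, hk, -⟩ := exists_zpowers_pow_eq hp hG hv
  have hkt : k ≤ t := by
    apply hbt.2
    obtain ⟨m, hm⟩ := Subgroup.mem_zpowers_iff.1 (hk.ge (Subgroup.mem_zpowers b))
    exact ⟨v ^ m, by rw [← hm, ← zpow_natCast, ← zpow_natCast, zpow_comm]⟩
  have h1 : v ^ p ^ k ∈ Subgroup.zpowers b := hk.le (Subgroup.mem_zpowers _)
  rw [← Nat.add_sub_cancel' hkt, pow_add, pow_mul]
  exact Subgroup.pow_mem _ h1 _

theorem pow_mem_zpowers_of_mem_closure_nbhd (hp : p.Prime) (hG : IsPGroup p G) (hb : b ≠ 1)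
    (hbt : HasHeight p b t) {v : G} (hv : v ∈ Subgroup.closure (nbhd b)) :
    v ^ p ^ t ∈ Subgroup.zpowers b := by
  have h : Subgroup.closure (nbhd b) ≤ (Subgroup.zpowers b).comap (powMonoidHom (p ^ t)) := by
    rw [Subgroup.closure_le]
    intro g hg
    obtain ⟨-, -, h | h⟩ := (mem_nbhd_iff hb).1 hg
    · exact Subgroup.pow_mem _ h _
    · exact pow_mem_zpowers_of_mem_zpowers hp hG hbt h
  exact h hv

-- Each `p`-th root of a nontrivial element of a `p`-group multiplies the order by `p`.
omit [Finite G] in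
theorem orderOf_eq_pow_mul_of_pow_eq (hp : p.Prime) (hG : IsPGroup p G) {g x : G} (hx : x ≠ 1)
    {k : ℕ} (h : g ^ p ^ k = x) : orderOf g = p ^ k * orderOf x := by
  have := Fact.mk hp
  induction k generalizing x with
  | zero => rw [← h, pow_zero, pow_one, one_mul]
  | succ k ih =>
    rw [pow_succ, pow_mul] at h
    have hx' : g ^ p ^ k ≠ 1 := fun h' => hx (by rw [← h, h', one_pow])
    rw [ih hx' rfl, orderOf_eq_mul_of_orderOf_pow hp (congrArg orderOf h) (hG.dvd_orderOf hx),
      pow_succ, mul_assoc]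

theorem mem_closure_nbhd_of_pow_eq (hp : p.Prime) (hG : IsPGroup p G) (hb : b ≠ 1) (ht : 1 ≤ t) {a : G}
    (ha : a ^ p ^ t = b) : a ∈ Subgroup.closure (nbhd b) := by
  refine Subgroup.subset_closure ((mem_nbhd_iff hb).2 ⟨?_, ?_, Or.inr ?_⟩)
  · rintro rfl
    exact hb (by rw [← ha, one_pow])
  · intro hab
    have h1 := orderOf_eq_pow_mul_of_pow_eq hp hG hb ha
    rw [hab] at h1
    have h2 := Nat.mul_le_mul_right (orderOf b) (Nat.one_lt_pow (by omega : t ≠ 0) hp.one_lt)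
    have h3 := orderOf_pos b
    omega
  · rw [← ha]
    exact Subgroup.npow_mem_zpowers a _

end Neighbourhood

/-! ### Internal direct products and their automorphisms -/

section DirectProduct

variable {G : Type*} [CommGroup G] {L K : Subgroup G}

/-- The multiplication map of two subgroups. -/
def mulHom (L K : Subgroup G) : L × K →* G := L.subtype.coprod K.subtype

theorem mulHom_apply (q : L × K) : mulHom L K q = (q.1 : G) * q.2 := rfl

theorem injective_mulHom (h : Disjoint L K) : Function.Injective (mulHom L K) := by
  rw [injective_iff_map_eq_one]
  rintro ⟨l, x⟩ hlx
  rw [mulHom_apply] at hlx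
  have h1 : (l : G) ∈ K := by
    rw [eq_inv_of_mul_eq_one_left hlx]
    exact K.inv_mem x.2
  have h2 : (l : G) = 1 := Subgroup.disjoint_def.1 h l.2 h1
  rw [h2, one_mul] at hlx
  exact Prod.ext (Subtype.ext h2) (Subtype.ext hlx)

theorem range_mulHom (L K : Subgroup G) : (mulHom L K).range = L ⊔ K := by
  ext g
  rw [Subgroup.mem_sup]
  constructor
  · rintro ⟨⟨l, x⟩, rfl⟩
    exact ⟨l, l.2, x, x.2, rfl⟩
  · rintro ⟨l, hl, x, hx, rfl⟩
    exact ⟨⟨⟨l, hl⟩, ⟨x, hx⟩⟩, rfl⟩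

/-- Cones of elements conjugate under an automorphism of a direct product are isomorphic. -/
theorem nonempty_coneBase_iso_of_mulEquiv (h : Disjoint L K) (T : L × K ≃* L × K) {q q' : L × K}
    (hT : T q = q') (hq : ∀ g : G, mulHom L K q ∈ Subgroup.zpowers g → g ∈ L ⊔ K)
    (hq' : ∀ g : G, mulHom L K q' ∈ Subgroup.zpowers g → g ∈ L ⊔ K) :
    Nonempty (coneBase (mulHom L K q) ≃g coneBase (mulHom L K q')) := by
  rw [← range_mulHom] at hq hq'
  obtain ⟨e1⟩ := nonempty_coneBase_iso (mulHom L K) (injective_mulHom h) q hq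
  obtain ⟨e2⟩ := nonempty_coneBase_iso (mulHom L K) (injective_mulHom h) q' hq'
  obtain ⟨e3⟩ := nonempty_coneBase_iso T.toMonoidHom T.injective q
    (fun g _ => ⟨T.symm g, T.apply_symm_apply g⟩)
  subst hT
  exact ⟨(e1.symm.trans e3).trans e2⟩

/-- The automorphism of a direct product given by a homomorphism between the factors. -/
def shear {L K : Type*} [CommGroup L] [CommGroup K] (f : K →* L) : L × K ≃* L × K where
  toFun q := (q.1 * f q.2, q.2)
  invFun q := (q.1 * (f q.2)⁻¹, q.2)
  left_inv q := by simp
  right_inv q := by simp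
  map_mul' q q' := by simp [mul_mul_mul_comm]

end DirectProduct

/-! ### Splitting the neighbourhood of `b` into cones -/

namespace Decomp

variable {G : Type*} [CommGroup G] [Finite G] {p : ℕ} {b : G} {t : ℕ} (D : Decomp p b t)

omit [Finite G] in
theorem nonempty_mulEquiv_pi : Nonempty (D.L ≃* ∀ s : (Σ i, Fin (D.r i)),
    Multiplicative (ZMod (p ^ D.e s.1))) := by
  have hcomm : Pairwise fun i j => ∀ x y : G, x ∈ D.F i → y ∈ D.F j → Commute x y :=
    fun _ _ _ x y _ _ => Commute.all x y
  have hinj := Subgroup.injective_noncommPiCoprod_of_iSupIndep (hcomm := hcomm) D.indep_F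
  let e1 := MonoidHom.ofInjective hinj
  let e2 : (Subgroup.noncommPiCoprod hcomm).range ≃* D.L :=
    MulEquiv.subgroupCongr (Subgroup.noncommPiCoprod_range.trans D.iSup_F)
  let e3 : (∀ i, D.F i) ≃* ∀ i, Fin (D.r i) → Multiplicative (ZMod (p ^ D.e i)) :=
    MulEquiv.piCongrRight fun i => (D.homocyclic i).some
  let e4 : (∀ i, Fin (D.r i) → Multiplicative (ZMod (p ^ D.e i))) ≃*
      ∀ s : (Σ i, Fin (D.r i)), Multiplicative (ZMod (p ^ D.e s.1)) :=
    { toFun := fun f s => f s.1 s.2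
      invFun := fun f i j => f ⟨i, j⟩
      left_inv := fun _ => rfl
      right_inv := fun _ => rfl
      map_mul' := fun _ _ => rfl }
  exact ⟨(e1.trans e2).symm.trans (e3.trans e4)⟩

omit [Finite G] in
theorem b_mem : b ∈ Subgroup.zpowers D.a := by
  have := Subgroup.npow_mem_zpowers D.a (p ^ t)
  rwa [D.a_pow] at this

/-- This confines all cones and roots to `L × ⟨a⟩`. The case `v = b` is separate because `b` is not
in its own open neighbourhood. -/
theorem mem_sup_of_mem_zpowers (hb : b ≠ 1) {v : G} (hv : b ∈ Subgroup.zpowers v) :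
    v ∈ D.L ⊔ Subgroup.zpowers D.a := by
  by_cases hvb : v = b
  · refine (le_sup_right : Subgroup.zpowers D.a ≤ _) ?_
    rw [hvb]
    exact D.b_mem
  · rw [D.sup_L]
    refine Subgroup.subset_closure ((mem_nbhd_iff hb).2 ⟨?_, hvb, Or.inr hv⟩)
    rintro rfl
    rw [Subgroup.zpowers_one_eq_bot, Subgroup.mem_bot] at hv
    exact hb hv

/-- The `p ^ t`-th power lies in `⟨b⟩ ≤ ⟨a⟩`, which meets `L` trivially. -/
theorem pow_eq_one (hp : p.Prime) (hG : IsPGroup p G) (hb : b ≠ 1) (hbt : HasHeight p b t)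
    (l : D.L) : l ^ p ^ t = 1 := by
  have h1 : (l : G) ∈ Subgroup.closure (nbhd b) := by
    rw [← D.sup_L]
    exact (le_sup_left : D.L ≤ _) l.2
  have h2 := pow_mem_zpowers_of_mem_closure_nbhd hp hG hb hbt h1
  have h3 : Subgroup.zpowers b ≤ Subgroup.zpowers D.a := by
    rw [Subgroup.zpowers_le]
    exact D.b_mem
  exact Subtype.ext (Subgroup.disjoint_def.1 D.disjoint_L (D.L.pow_mem l.2 _) (h3 h2))

omit [Finite G] in
theorem orderOf_a (hp : p.Prime) (hG : IsPGroup p G) (hb : b ≠ 1) :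
    orderOf D.a = p ^ t * orderOf b :=
  orderOf_eq_pow_mul_of_pow_eq hp hG hb D.a_pow

theorem zpowers_c_pow (hp : p.Prime) : Subgroup.zpowers (D.c ^ p) = Subgroup.zpowers b := by
  refine zpowers_eq_of_mem_zpowers (g := D.a) (Subgroup.pow_mem _ D.c_mem _) D.b_mem ?_
  rw [orderOf_pow_of_dvd hp.ne_zero (D.orderOf_c ▸ dvd_mul_right _ _), D.orderOf_c,
    Nat.mul_div_cancel_left _ hp.pos]

omit [Finite G] in
theorem c_ne_one (hp : p.Prime) : D.c ≠ 1 := by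
  intro h
  have := D.orderOf_c
  rw [h, orderOf_one] at this
  exact hp.one_lt.ne' (Nat.dvd_one.1 (Dvd.intro _ this.symm))

/-- There is a generator of `⟨a⟩` having `c` as its `p ^ (t - 1)`-th power. -/
theorem exists_root_c (hp : p.Prime) (hG : IsPGroup p G) (hb : b ≠ 1) (ht : 1 ≤ t) :
    ∃ a₀ : G, Subgroup.zpowers a₀ = Subgroup.zpowers D.a ∧ a₀ ^ p ^ (t - 1) = D.c := by
  have h1 : (D.a ^ p ^ (t - 1)) ^ p = b := by
    rw [← pow_mul, ← pow_succ, Nat.sub_add_cancel ht, D.a_pow]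
  have h2 : orderOf (D.a ^ p ^ (t - 1)) = p * orderOf b := by
    rw [orderOf_eq_pow_mul_of_pow_eq hp hG hb (k := 1) (by rw [pow_one, h1]), pow_one]
  have h3 : Subgroup.zpowers D.c = Subgroup.zpowers (D.a ^ p ^ (t - 1)) :=
    zpowers_eq_of_mem_zpowers D.c_mem (Subgroup.npow_mem_zpowers _ _) (D.orderOf_c.trans h2.symm)
  obtain ⟨m, hm⟩ := Subgroup.mem_zpowers_iff.1 (h3.le (Subgroup.mem_zpowers D.c))
  have h4 : (D.a ^ m) ^ p ^ (t - 1) = D.c := by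
    rw [← hm, ← zpow_natCast, ← zpow_natCast, zpow_comm]
  refine ⟨D.a ^ m, zpowers_eq_of_mem_zpowers (g := D.a) (Subgroup.zpow_mem_zpowers _ _)
    (Subgroup.mem_zpowers _) ?_, h4⟩
  rw [D.orderOf_a hp hG hb, orderOf_eq_pow_mul_of_pow_eq hp hG (D.c_ne_one hp) h4, D.orderOf_c,
    ← mul_assoc, ← pow_succ, Nat.sub_add_cancel ht]

/-- The elements of `L` of order dividing `p`. -/
abbrev Socle : Type _ := {y : D.L // y ^ p = 1}

omit [Finite G] in
theorem mul_c_pow (y : D.Socle) : ((y.1 : G) * D.c) ^ p = D.c ^ p := by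
  rw [mul_pow, ← Subgroup.coe_pow, y.2, Subgroup.coe_one, one_mul]

theorem orderOf_mul_c (hp : p.Prime) (hG : IsPGroup p G) (hb : b ≠ 1) (y : D.Socle) :
    orderOf ((y.1 : G) * D.c) = p * orderOf b := by
  have := Fact.mk hp
  refine orderOf_eq_mul_of_orderOf_pow hp ?_ (hG.dvd_orderOf hb)
  rw [D.mul_c_pow y]
  exact orderOf_eq_of_zpowers_eq (D.zpowers_c_pow hp)

theorem mul_c_ne_one (hp : p.Prime) (hG : IsPGroup p G) (hb : b ≠ 1) (y : D.Socle) :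
    (y.1 : G) * D.c ≠ 1 := by
  intro h
  have := D.orderOf_mul_c hp hG hb y
  rw [h, orderOf_one] at this
  exact hp.one_lt.ne' (Nat.dvd_one.1 (Dvd.intro _ this.symm))

theorem mem_zpowers_of_mul_c_mem (hp : p.Prime) (y : D.Socle) {v : G}
    (hv : (y.1 : G) * D.c ∈ Subgroup.zpowers v) : b ∈ Subgroup.zpowers v := by
  have h1 : b ∈ Subgroup.zpowers (D.c ^ p) := (D.zpowers_c_pow hp).ge (Subgroup.mem_zpowers b)
  refine Subgroup.zpowers_le.2 ?_ h1
  rw [← D.mul_c_pow y]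
  exact Subgroup.pow_mem _ hv _

omit [Finite G] in
/-- The decomposition of an element of `L × ⟨a⟩`. -/
theorem eq_and_eq_of_mul_eq {l l' x x' : G} (hl : l ∈ D.L) (hl' : l' ∈ D.L)
    (hx : x ∈ Subgroup.zpowers D.a) (hx' : x' ∈ Subgroup.zpowers D.a) (h : l * x = l' * x') :
    l = l' ∧ x = x' := by
  have := injective_mulHom D.disjoint_L
    (show mulHom D.L (Subgroup.zpowers D.a) (⟨l, hl⟩, ⟨x, hx⟩) = mulHom _ _ (⟨l', hl'⟩, ⟨x', hx'⟩)
      from h)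
  simpa using this

/-- Elements of equal order in a cyclic group generate the same subgroup, so `y c = (y' c) ^ m`. The
second coordinate gives `m ≡ 1` modulo `o(c)`, hence modulo `p`, and then `y' ^ m = y'`. -/
theorem socle_eq_of_mul_c_mem (hp : p.Prime) (hG : IsPGroup p G) (hb : b ≠ 1) (y y' : D.Socle)
    (v : G) (h : (y.1 : G) * D.c ∈ Subgroup.zpowers v)
    (h' : (y'.1 : G) * D.c ∈ Subgroup.zpowers v) : y = y' := by
  have h1 := zpowers_eq_of_mem_zpowers h h'
    ((D.orderOf_mul_c hp hG hb y).trans (D.orderOf_mul_c hp hG hb y').symm)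
  obtain ⟨m, hm⟩ := Subgroup.mem_zpowers_iff.1 (h1.le (Subgroup.mem_zpowers _))
  rw [mul_zpow] at hm
  obtain ⟨h2, h3⟩ := D.eq_and_eq_of_mul_eq (D.L.zpow_mem y'.1.2 m) y.1.2
    (Subgroup.zpow_mem _ D.c_mem m) D.c_mem hm
  have h4 : (p : ℤ) ∣ m - 1 := by
    have h5 : D.c ^ (m - 1) = 1 := by rw [zpow_sub, h3, zpow_one, mul_inv_cancel]
    rw [← orderOf_dvd_iff_zpow_eq_one, D.orderOf_c, Nat.cast_mul] at h5
    exact dvd_of_mul_right_dvd h5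
  have h6 : y'.1 ^ (m - 1) = 1 := by
    obtain ⟨q, hq⟩ := h4
    rw [hq, zpow_mul, zpow_natCast, y'.2, one_zpow]
  have h7 : y'.1 ^ m = y'.1 := by
    rwa [zpow_sub, zpow_one, mul_inv_eq_one] at h6
  refine Subtype.ext (Subtype.ext ?_)
  rw [← h2, ← Subgroup.coe_zpow, h7]

/-- Some power `v₀ = l x` of `v` has `⟨v₀ ^ p⟩ = ⟨b⟩`. Then `l ^ p = 1` and `o(x) = o(c)`, so `c = x
^ m` and `v₀ ^ m = l ^ m c`. -/
theorem exists_mul_c_mem_zpowers (hp : p.Prime) (hG : IsPGroup p G) (hb : b ≠ 1) {v : G}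
    (hv : b ∈ Subgroup.zpowers v) (hvb : v ∉ Subgroup.zpowers b) :
    ∃ y : D.Socle, (y.1 : G) * D.c ∈ Subgroup.zpowers v := by
  have := Fact.mk hp
  obtain ⟨k, hk, -⟩ := exists_zpowers_pow_eq hp hG hv
  obtain _ | k := k
  · rw [pow_zero, pow_one] at hk
    exact absurd (hk.le (Subgroup.mem_zpowers v)) hvb
  set v₀ := v ^ p ^ k with hv₀
  have h0 : v₀ ∈ Subgroup.zpowers v := Subgroup.npow_mem_zpowers _ _
  rw [pow_succ, pow_mul, ← hv₀] at hk
  have h1 : v₀ ∈ D.L ⊔ Subgroup.zpowers D.a :=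
    Subgroup.pow_mem _ (D.mem_sup_of_mem_zpowers hb hv) _
  obtain ⟨l, hl, x, hx, hlx⟩ := Subgroup.mem_sup.1 h1
  have h2 : v₀ ^ p ∈ Subgroup.zpowers D.a :=
    Subgroup.zpowers_le.2 D.b_mem (hk.le (Subgroup.mem_zpowers _))
  obtain ⟨h3, h4⟩ := D.eq_and_eq_of_mul_eq (D.L.pow_mem hl p) D.L.one_mem
    (Subgroup.pow_mem _ hx p) h2 (by rw [← mul_pow, hlx, one_mul])
  have h5 : orderOf x = p * orderOf b := by
    refine orderOf_eq_mul_of_orderOf_pow hp ?_ (hG.dvd_orderOf hb)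
    rw [h4]
    exact orderOf_eq_of_zpowers_eq hk
  obtain ⟨m, hm⟩ := Subgroup.mem_zpowers_iff.1 ((zpowers_eq_of_mem_zpowers D.c_mem hx
    (D.orderOf_c.trans h5.symm)).le (Subgroup.mem_zpowers _))
  refine ⟨⟨⟨l, hl⟩ ^ m, Subtype.ext ?_⟩, ?_⟩
  · change (l ^ m) ^ p = 1
    rw [← zpow_natCast, zpow_comm, zpow_natCast, h3, one_zpow]
  · change l ^ m * D.c ∈ _
    rw [← hm, ← mul_zpow, hlx]
    exact Subgroup.zpow_mem _ h0 m

theorem nonempty_sigmaGraph_iso_hatBase (hp : p.Prime) (hG : IsPGroup p G) (hb : b ≠ 1) :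
    Nonempty (sigmaGraph (fun y : D.Socle => coneBase ((y.1 : G) * D.c)) ≃g hatBase b) := by
  apply nonempty_sigmaGraph_coneBase_iso
  · intro y v hv
    rw [mem_hatSet_iff hb]
    refine ⟨D.mem_zpowers_of_mul_c_mem hp y hv, fun h => ?_⟩
    have h1 := orderOf_dvd_of_mem_zpowers (Subgroup.zpowers_le.2 h hv)
    rw [D.orderOf_mul_c hp hG hb] at h1
    have h2 := Nat.le_of_dvd (orderOf_pos b) h1
    have h3 := Nat.mul_le_mul_right (orderOf b) hp.two_le
    have h4 := orderOf_pos b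
    omega
  · intro v hv
    obtain ⟨h1, h2⟩ := (mem_hatSet_iff hb).1 hv
    exact D.exists_mul_c_mem_zpowers hp hG hb h1 h2
  · exact D.socle_eq_of_mul_c_mem hp hG hb

/-- The height of `y c` is the height of `y` in `L`. -/
theorem hasHeight_mul_c (hp : p.Prime) (hG : IsPGroup p G) (hb : b ≠ 1) (ht : 1 ≤ t)
    (y : D.Socle) {k : ℕ} (hk : k ≤ t - 1) (h : ∃ w : D.L, w ^ p ^ k = y.1)
    (h' : ∀ l ≤ t - 1, (∃ w : D.L, w ^ p ^ l = y.1) → l ≤ k) :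
    HasHeight p ((y.1 : G) * D.c) k := by
  obtain ⟨a₀, ha₀, hac⟩ := D.exists_root_c hp hG hb ht
  constructor
  · obtain ⟨w, hw⟩ := h
    refine ⟨w * a₀ ^ p ^ (t - 1 - k), ?_⟩
    rw [mul_pow, ← pow_mul, ← pow_add, Nat.sub_add_cancel hk, hac, ← hw, Subgroup.coe_pow]
  · rintro l ⟨g, hg⟩
    have h1 : (y.1 : G) * D.c ∈ Subgroup.zpowers g := by
      rw [← hg]
      exact Subgroup.npow_mem_zpowers _ _
    have h2 := D.mem_sup_of_mem_zpowers hb (D.mem_zpowers_of_mul_c_mem hp y h1)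
    obtain ⟨w, hw, x, hx, rfl⟩ := Subgroup.mem_sup.1 h2
    rw [mul_pow] at hg
    obtain ⟨h3, h4⟩ := D.eq_and_eq_of_mul_eq (D.L.pow_mem hw _) y.1.2 (Subgroup.pow_mem _ hx _)
      D.c_mem hg
    refine h' l ?_ ⟨⟨w, hw⟩, Subtype.ext h3⟩
    -- The `p ^ l`-th root `x` of `c` has order `p ^ l · p · o(b)`, which divides `o(a) = p ^ t ·
    -- o(b)`; hence `l ≤ t - 1`.
    have h5 := orderOf_dvd_of_mem_zpowers hx
    rw [orderOf_eq_pow_mul_of_pow_eq hp hG (D.c_ne_one hp) h4, D.orderOf_a hp hG hb, D.orderOf_c,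
      ← mul_assoc, ← pow_succ] at h5
    have h6 := Nat.dvd_of_mul_dvd_mul_right (orderOf_pos b) h5
    have := (Nat.pow_dvd_pow_iff_le_right hp.one_lt).1 h6
    omega

end Decomp

/-! ### Heights in `Ω_n` and cut-off heights -/

section Omega

variable {A : Type*} [CommGroup A] {p n : ℕ}

theorem hasHeight_coe_omega (h : ∀ l : A, l ∈ Omega p n A) (x : Omega p n A) (k : ℕ) :
    HasHeight p (x : A) k ↔ HasHeight p x k := by
  have : {k : ℕ | ∃ y : A, y ^ p ^ k = x} = {k : ℕ | ∃ y : Omega p n A, y ^ p ^ k = x} := by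
    ext k
    constructor
    · rintro ⟨y, hy⟩
      exact ⟨⟨y, h y⟩, Subtype.ext hy⟩
    · rintro ⟨y, hy⟩
      exact ⟨y, by rw [← hy, Subgroup.coe_pow]⟩
  unfold HasHeight
  rw [this]

theorem mem_hSet_omega_iff (h : ∀ l : A, l ∈ Omega p n A) {x : Omega p n A} {e : ℕ} (he : 0 < e) :
    x ∈ HSet p e (Omega p n A) ↔ orderOf (x : A) = p ∧ HasHeight p (x : A) (e - 1) := by
  change orderOf x = p ∧ _ ↔ _
  rw [Subgroup.orderOf_coe, hasHeight_coe_omega h]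
  refine and_congr_right fun _ => ⟨?_, fun h => ⟨e - 1, Nat.sub_add_cancel he, h⟩⟩
  rintro ⟨k, rfl, hk⟩
  exact hk

theorem orderOf_eq_of_hasHeight (hp : p.Prime) {y : A} {k : ℕ} (hy : y ^ p = 1)
    (h : HasHeight p y k) : orderOf y = p := by
  have := Fact.mk hp
  refine orderOf_eq_prime hy ?_
  rintro rfl
  exact absurd (h.2 ⟨1, one_pow (p ^ (k + 1))⟩) (by simp)

/-- A maximum taken up to the cutoff `m` and strictly below it is genuine: a root of exponent beyond
`m` would yield one of exponent `m`. -/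
theorem hasHeight_of_forall_le {y : A} {k m : ℕ} (hk : k < m)
    (h : ∃ w : A, w ^ p ^ k = y) (h' : ∀ l ≤ m, (∃ w : A, w ^ p ^ l = y) → l ≤ k) :
    HasHeight p y k := by
  refine ⟨h, ?_⟩
  rintro l ⟨w, hw⟩
  rcases le_total l m with hl | hl
  · exact h' l hl ⟨w, hw⟩
  · refine absurd (h' m le_rfl ⟨w ^ p ^ (l - m), ?_⟩) (not_le.2 hk)
    rw [← pow_mul, ← pow_add, Nat.sub_add_cancel hl, hw]

end Omega

/-- Wreath products of isomorphic groups are isomorphic. -/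
def wreathSymCongr {A B : Type*} [Group A] [Group B] (e : A ≃* B) (k : ℕ) :
    WreathSym A k ≃* WreathSym B k :=
  SemidirectProduct.congr (MulEquiv.piCongrRight fun _ => e) (MulEquiv.refl _) fun _ => rfl

/-- A product over `Option` splits. -/
def mulEquivPiOption {α : Type*} {X : Option α → Type*} [∀ j, Group (X j)] :
    (∀ j, X j) ≃* (∀ i, X (some i)) × X none where
  toFun f := (fun i => f (some i), f none)
  invFun q j := match j with
    | none => q.2
    | some i => q.1 i
  left_inv f := by
    funext j
    cases j <;> rfl
  right_inv _ := rfl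
  map_mul' _ _ := rfl

/-! ### Classes of cones and their multiplicities -/

namespace Decomp

variable {G : Type*} [CommGroup G] [Finite G] {p : ℕ} {b : G} {t : ℕ} (D : Decomp p b t)

/-- The heights in `L × ⟨a⟩` of the elements `x_i c` and `c`. -/
def height : Option (Fin D.m') → ℕ
  | none => t - 1
  | some i => D.e i.castSucc - 1

/-- The elements `x_i c` and `c`. -/
def rep : Option (Fin D.m') → G
  | none => D.c
  | some i => D.pair i

/-- The elements `x_i` and `1`. -/
def base : Option (Fin D.m') → D.L
  | none => 1
  | some i => ((D.x i : Omega p (t + 1) D.L) : D.L)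

omit [Finite G] in
theorem rep_eq (j : Option (Fin D.m')) : D.rep j = (D.base j : G) * D.c := by
  cases j with
  | none => exact (one_mul _).symm
  | some i => rfl

omit [Finite G] in
theorem base_pow (j : Option (Fin D.m')) : D.base j ^ p = 1 := by
  cases j with
  | none => exact one_pow _
  | some i =>
    have h := (D.x i).2.1
    rw [← Subgroup.orderOf_coe] at h
    exact orderOf_dvd_iff_pow_eq_one.1 h.dvd

omit [Finite G] in
theorem e_lt (i : Fin D.m') : D.e i.castSucc < t := by
  have h := D.e_strictMono (Fin.castSucc_lt_last i)
  rwa [D.e_last] at h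

omit [Finite G] in
theorem height_le (j : Option (Fin D.m')) : D.height j ≤ t - 1 := by
  cases j with
  | none => exact le_rfl
  | some i =>
    have := D.e_lt i
    change D.e i.castSucc - 1 ≤ t - 1
    omega

omit [Finite G] in
theorem injective_height : Function.Injective D.height := by
  have h1 := fun i => D.e_lt i
  have h2 := fun i : Fin D.m' => D.e_pos i.castSucc
  intro j j' h
  cases j with
  | none =>
    cases j' with
    | none => rfl
    | some i' =>
      have h : t - 1 = D.e i'.castSucc - 1 := h
      have := h1 i'
      have := h2 i'
      omega
  | some i =>
    cases j' with
    | none =>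
      have h : D.e i.castSucc - 1 = t - 1 := h
      have := h1 i
      have := h2 i
      omega
    | some i' =>
      have h : D.e i.castSucc - 1 = D.e i'.castSucc - 1 := h
      have := h2 i
      have := h2 i'
      have h' : D.e i.castSucc = D.e i'.castSucc := by omega
      rw [Fin.castSucc_injective _ (D.e_strictMono.injective h')]

/-- The height of `y`, cut off at `t - 1`, is the `j`-th one. -/
def IsClass (y : D.Socle) (j : Option (Fin D.m')) : Prop :=
  (∃ w : D.L, w ^ p ^ D.height j = y.1) ∧
    ∀ l ≤ t - 1, (∃ w : D.L, w ^ p ^ l = y.1) → l ≤ D.height j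

-- The bound on `l` is vacuous here. This class contains `y = 1`, which has roots of every exponent
-- and so no height; this is why heights are cut off.
omit [Finite G] in
theorem isClass_none_iff {y : D.Socle} :
    D.IsClass y none ↔ ∃ w : D.L, w ^ p ^ (t - 1) = y.1 :=
  and_iff_left fun _ hl _ => hl

omit [Finite G] in
theorem isClass_some_iff {y : D.Socle} {i : Fin D.m'} :
    D.IsClass y (some i) ↔ HasHeight p y.1 (D.e i.castSucc - 1) := by
  have h1 := D.e_lt i
  have h2 := D.e_pos i.castSucc
  constructor
  · rintro ⟨h, h'⟩
    exact hasHeight_of_forall_le (by omega : D.e i.castSucc - 1 < t - 1) h h'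
  · intro h
    exact ⟨h.1, fun l _ hl => h.2 hl⟩

omit [Finite G] in
theorem isClass_unique {y : D.Socle} {j j' : Option (Fin D.m')} (h : D.IsClass y j)
    (h' : D.IsClass y j') : j = j' :=
  D.injective_height (le_antisymm (h'.2 _ (D.height_le j) h.1) (h.2 _ (D.height_le j') h'.1))

-- A cut-off height below `t - 1` is a true height, and a nontrivial coordinate shows that it is
-- `e_i - 1` for some factor other than the last.
omit [Finite G] in
theorem exists_isClass (hp : p.Prime) (y : D.Socle) : ∃ j, D.IsClass y j := by
  classical
  obtain ⟨E⟩ := D.nonempty_mulEquiv_pi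
  let P : ℕ → Prop := fun l => ∃ w : D.L, w ^ p ^ l = y.1
  have h0 : P 0 := ⟨y.1, by rw [pow_zero, pow_one]⟩
  have h1 : P (Nat.findGreatest P (t - 1)) := Nat.findGreatest_spec (Nat.zero_le _) h0
  have h2 : ∀ l ≤ t - 1, P l → l ≤ Nat.findGreatest P (t - 1) := fun l hl h =>
    Nat.le_findGreatest hl h
  rcases (Nat.findGreatest_le (P := P) (t - 1)).eq_or_lt with h | h
  · rw [h] at h1
    exact ⟨none, D.isClass_none_iff.2 h1⟩
  · have hh := hasHeight_of_forall_le h h1 h2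
    obtain ⟨⟨i, k⟩, hs, -⟩ := exists_coordinate_of_hasHeight E hp (fun s => D.e_pos s.1) y.2 hh
    have hi : i ≠ Fin.last D.m' := by
      rintro rfl
      have := D.e_last
      change D.e (Fin.last D.m') = _ at hs
      omega
    obtain ⟨i, rfl⟩ := Fin.exists_castSucc_eq.2 hi
    refine ⟨some i, D.isClass_some_iff.2 ?_⟩
    change D.e i.castSucc = _ at hs
    rwa [hs, Nat.add_sub_cancel]

theorem mem_omega (hp : p.Prime) (hG : IsPGroup p G) (hb : b ≠ 1) (hbt : HasHeight p b t)
    (l : D.L) : l ∈ Omega p (t + 1) D.L := by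
  change l ^ p ^ (t + 1) = 1
  rw [pow_succ, pow_mul, D.pow_eq_one hp hG hb hbt l, one_pow]

theorem isClass_base (hp : p.Prime) (hG : IsPGroup p G) (hb : b ≠ 1) (hbt : HasHeight p b t)
    (j : Option (Fin D.m')) : D.IsClass ⟨D.base j, D.base_pow j⟩ j := by
  cases j with
  | none => exact D.isClass_none_iff.2 ⟨1, one_pow _⟩
  | some i =>
    rw [isClass_some_iff]
    exact ((mem_hSet_omega_iff (D.mem_omega hp hG hb hbt) (D.e_pos _)).1 (D.x i).2).2

/-- An automorphism of `L × ⟨a⟩` carrying `(base j, c)` to `(y, c)` carries one cone to the other.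
It is a shear for `none`, and comes from an automorphism of `L` for `some i`. -/
theorem nonempty_coneBase_iso (hp : p.Prime) (hG : IsPGroup p G) (hb : b ≠ 1) (ht : 1 ≤ t)
    (hbt : HasHeight p b t) {y : D.Socle} {j : Option (Fin D.m')} (h : D.IsClass y j) :
    Nonempty (coneBase ((y.1 : G) * D.c) ≃g coneBase (D.rep j)) := by
  have hsup : ∀ (y : D.Socle) (g : G), (y.1 : G) * D.c ∈ Subgroup.zpowers g →
      g ∈ D.L ⊔ Subgroup.zpowers D.a := fun y g hg =>
    D.mem_sup_of_mem_zpowers hb (D.mem_zpowers_of_mul_c_mem hp y hg)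
  have key : ∀ y' : D.Socle,
      (∃ T : D.L × Subgroup.zpowers D.a ≃* D.L × Subgroup.zpowers D.a,
        T (y'.1, ⟨D.c, D.c_mem⟩) = (y.1, ⟨D.c, D.c_mem⟩)) →
      Nonempty (coneBase ((y.1 : G) * D.c) ≃g coneBase ((y'.1 : G) * D.c)) := by
    rintro y' ⟨T, hT⟩
    obtain ⟨e⟩ := nonempty_coneBase_iso_of_mulEquiv D.disjoint_L T hT (hsup y') (hsup y)
    exact ⟨e.symm⟩
  rw [rep_eq]
  refine key ⟨D.base j, D.base_pow j⟩ ?_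
  cases j with
  | none =>
    obtain ⟨w, hw⟩ := D.isClass_none_iff.1 h
    obtain ⟨a₀, ha₀, hac⟩ := D.exists_root_c hp hG hb ht
    let g : Subgroup.zpowers D.a := ⟨a₀, ha₀.le (Subgroup.mem_zpowers a₀)⟩
    have hg : ∀ x, x ∈ Subgroup.zpowers g := by
      rintro ⟨x, hx⟩
      obtain ⟨m, hm⟩ := Subgroup.mem_zpowers_iff.1 (ha₀.ge hx)
      exact Subgroup.mem_zpowers_iff.2 ⟨m, Subtype.ext hm⟩
    -- `o(w)` divides `p ^ t`, which divides `o(a)`, so `a₀ ↦ w` defines a homomorphism. It sends `c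
    -- = a₀ ^ p ^ (t - 1)` to `w ^ p ^ (t - 1) = y`.
    have hw' : orderOf w ∣ orderOf g := by
      rw [← Subgroup.orderOf_coe g, orderOf_eq_of_zpowers_eq ha₀, D.orderOf_a hp hG hb]
      exact (orderOf_dvd_of_pow_eq_one (D.pow_eq_one hp hG hb hbt w)).mul_right _
    refine ⟨shear (monoidHomOfForallMemZpowers hg hw'), Prod.ext ?_ rfl⟩
    change 1 * monoidHomOfForallMemZpowers hg hw' ⟨D.c, D.c_mem⟩ = y.1
    have hc : (⟨D.c, D.c_mem⟩ : Subgroup.zpowers D.a) = g ^ p ^ (t - 1) :=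
      Subtype.ext hac.symm
    rw [one_mul, hc, map_pow, monoidHomOfForallMemZpowers_apply_gen, hw]
  | some i =>
    obtain ⟨E⟩ := D.nonempty_mulEquiv_pi
    obtain ⟨T, hT⟩ := exists_mulEquiv_of_hasHeight E hp (fun s => D.e_pos s.1)
      (D.base_pow (some i)) (D.isClass_some_iff.1 (D.isClass_base hp hG hb hbt (some i))) y.2
      (D.isClass_some_iff.1 h)
    exact ⟨MulEquiv.prodCongr T (MulEquiv.refl _), Prod.ext hT rfl⟩

/-- The number of elements of a class. -/
noncomputable def mult : Option (Fin D.m') → ℕ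
  | none => p ^ D.r (Fin.last D.m')
  | some i => D.k i

theorem card_isClass (hp : p.Prime) (hG : IsPGroup p G) (hb : b ≠ 1) (ht : 1 ≤ t)
    (hbt : HasHeight p b t) (j : Option (Fin D.m')) :
    Nat.card {y : D.Socle // D.IsClass y j} = D.mult j := by
  cases j with
  | none =>
    obtain ⟨E⟩ := D.nonempty_mulEquiv_pi
    have h1 := card_pow_eq_one_and_exists_pow E hp (fun s => D.e_pos s.1) (t - 1)
    -- Only the cyclic factors of the last homocyclic group have exponent above `t - 1`.
    have h2 : Nat.card {s : (Σ i, Fin (D.r i)) // t - 1 < D.e s.1} = D.r (Fin.last D.m') := by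
      rw [← Nat.card_fin (D.r (Fin.last D.m'))]
      have hlast : t - 1 < D.e (Fin.last D.m') := by
        rw [D.e_last]
        omega
      refine (Nat.card_congr (Equiv.ofBijective (fun k => ⟨⟨Fin.last D.m', k⟩, hlast⟩)
        ⟨fun k k' h => ?_, ?_⟩)).symm
      · exact eq_of_heq (Sigma.mk.inj (congrArg Subtype.val h)).2
      · rintro ⟨⟨i, k⟩, hi⟩
        obtain rfl : i = Fin.last D.m' := by
          by_contra hne
          obtain ⟨i, rfl⟩ := Fin.exists_castSucc_eq.2 hne
          have := D.e_lt i
          change t - 1 < D.e i.castSucc at hi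
          omega
        exact ⟨k, rfl⟩
    rw [h2] at h1
    refine Eq.trans (Nat.card_congr ?_) h1
    exact (Equiv.subtypeEquivRight fun y => D.isClass_none_iff).trans
      (Equiv.subtypeSubtypeEquivSubtypeInter (fun y : D.L => y ^ p = 1)
        (fun y => ∃ w : D.L, w ^ p ^ (t - 1) = y))
  | some i =>
    have hO := D.mem_omega hp hG hb hbt
    have hH := fun x => mem_hSet_omega_iff hO (x := x) (D.e_pos i.castSucc)
    refine Nat.card_congr ⟨fun y => ⟨⟨y.1.1, hO _⟩, ?_⟩, fun x => ⟨⟨x.1.1, ?_⟩, ?_⟩, fun _ => rfl,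
      fun _ => rfl⟩
    · have h := D.isClass_some_iff.1 y.2
      exact (hH _).2 ⟨orderOf_eq_of_hasHeight hp y.1.2 h, h⟩
    · exact orderOf_dvd_iff_pow_eq_one.1 ((hH _).1 x.2).1.dvd
    · exact D.isClass_some_iff.2 ((hH _).1 x.2).2

theorem hasHeight_rep (hp : p.Prime) (hG : IsPGroup p G) (hb : b ≠ 1) (ht : 1 ≤ t)
    (hbt : HasHeight p b t) (j : Option (Fin D.m')) : HasHeight p (D.rep j) (D.height j) := by
  rw [rep_eq]
  obtain ⟨h1, h2⟩ := D.isClass_base hp hG hb hbt j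
  exact D.hasHeight_mul_c hp hG hb ht ⟨D.base j, D.base_pow j⟩ (D.height_le j) h1 h2

/-- The structure of the automorphism group, for given choices. -/
theorem nonempty_autHat_mulEquiv (hp : p.Prime) (hG : IsPGroup p G) (hb : b ≠ 1) (ht : 1 ≤ t)
    (hbt : HasHeight p b t) :
    Nonempty (AutHat b ≃* ((i : Fin D.m') → WreathSym (AutHat (D.pair i)) (D.k i)) ×
      WreathSym (AutHat D.c) (p ^ D.r (Fin.last D.m'))) := by
  have hrep : ∀ j, D.rep j ≠ 1 := fun j => by
    rw [rep_eq]
    exact D.mul_c_ne_one hp hG hb ⟨D.base j, D.base_pow j⟩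
  have hord : ∀ j, orderOf (D.rep j) = p * orderOf b := fun j => by
    rw [rep_eq]
    exact D.orderOf_mul_c hp hG hb ⟨D.base j, D.base_pow j⟩
  choose κ hκ using D.exists_isClass hp
  have hfib : ∀ j, Nat.card {y // κ y = j} = D.mult j := by
    intro j
    rw [← D.card_isClass hp hG hb ht hbt j]
    refine Nat.card_congr (Equiv.subtypeEquivRight fun y => ?_)
    exact ⟨fun h => h ▸ hκ y, D.isClass_unique (hκ y)⟩
  let e : D.Socle ≃ Σ j, Fin (D.mult j) := (Equiv.sigmaFiberEquiv κ).symm.trans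
    (Equiv.sigmaCongrRight fun j => Finite.equivFinOfCardEq (hfib j))
  let f : ∀ y, coneBase ((y.1 : G) * D.c) ≃g coneBase (D.rep (e y).1) := fun y =>
    (D.nonempty_coneBase_iso hp hG hb ht hbt (hκ y)).some
  let e1 := sigmaGraphCongr (Γ := fun y : D.Socle => coneBase ((y.1 : G) * D.c))
    (Γ' := fun q : (Σ j, Fin (D.mult j)) => coneBase (D.rep q.1)) e f
  obtain ⟨e2⟩ := D.nonempty_sigmaGraph_iso_hatBase hp hG hb
  obtain ⟨e3⟩ := nonempty_wreath_mulEquiv_autMen (fun j => coneBase (D.rep j)) D.mult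
    (fun j => ⟨⟨D.rep j, hrep j⟩, Subgroup.mem_zpowers _⟩)
    (fun j => isDominating_coneBase _ (Subgroup.mem_zpowers _))
    -- The apexes have the same order `p · o(b)` but pairwise different heights, so the cones have
    -- different sizes.
    (fun j j' h => D.injective_height (height_eq_of_card_coneSet_eq hp hG (hrep j)
      ((hord j).trans (hord j').symm) (D.hasHeight_rep hp hG hb ht hbt j)
      (D.hasHeight_rep hp hG hb ht hbt j') h))
  let e4 : (∀ j, WreathSym (AutMen (coneBase (D.rep j))) (D.mult j)) ≃*
      ∀ j, WreathSym (AutHat (D.rep j)) (D.mult j) :=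
    MulEquiv.piCongrRight fun j =>
      wreathSymCongr (nonempty_autMen_coneBase_mulEquiv_autHat (hrep j)).some _
  let e5 : AutHat b ≃* ∀ j, WreathSym (AutHat (D.rep j)) (D.mult j) :=
    ((autMenCongr (e2.symm.trans e1)).trans e3.symm).trans e4
  exact ⟨e5.trans mulEquivPiOption⟩

end Decomp

/-! ### Splitting off a cyclic subgroup of maximal order -/

section Complement

/-- A cyclic subgroup whose order is the exponent of the group has a complement. -/
theorem exists_isCompl_zpowers {N : Type*} [CommGroup N] [Finite N] (a : N)
    (ha : ∀ n : N, n ^ orderOf a = 1) : ∃ L : Subgroup N, IsCompl L (Subgroup.zpowers a) := by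
  have hpos : orderOf a ≠ 0 := (orderOf_pos a).ne'
  have := NeZero.mk hpos
  -- Extend a faithful character of `⟨a⟩` to `N`. By the exponent hypothesis its values remain
  -- powers of `ζ = χ a`, so its kernel is a complement.
  obtain ⟨ζ, hζ⟩ : ∃ ζ : ℂˣ, IsPrimitiveRoot ζ (orderOf a) := by
    have h := Complex.isPrimitiveRoot_exp _ hpos
    exact ⟨h.toRootsOfUnity.1, IsPrimitiveRoot.coe_units_iff.1 (by simpa using h)⟩
  let g : Subgroup.zpowers a := ⟨a, Subgroup.mem_zpowers a⟩
  have hg : ∀ x, x ∈ Subgroup.zpowers g := by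
    rintro ⟨x, hx⟩
    obtain ⟨m, hm⟩ := Subgroup.mem_zpowers_iff.1 hx
    exact Subgroup.mem_zpowers_iff.2 ⟨m, Subtype.ext hm⟩
  have hζ' : orderOf ζ ∣ orderOf g := by
    rw [← hζ.eq_orderOf, ← Subgroup.orderOf_coe g]
  obtain ⟨χ, hχ⟩ := MonoidHom.domRestrict_surjective (M := ℂ) (Subgroup.zpowers a)
    (monoidHomOfForallMemZpowers hg hζ')
  have hχa : χ a = ζ := by
    have h := congrArg (fun f => f g) hχ
    rw [monoidHomOfForallMemZpowers_apply_gen] at h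
    exact h
  refine ⟨χ.ker, ?_, ?_⟩
  · rw [Subgroup.disjoint_def]
    intro x hx hx'
    obtain ⟨m, rfl⟩ := Subgroup.mem_zpowers_iff.1 hx'
    rw [MonoidHom.mem_ker, map_zpow, hχa, hζ.zpow_eq_one_iff_dvd] at hx
    exact orderOf_dvd_iff_zpow_eq_one.1 hx
  · rw [codisjoint_iff, eq_top_iff]
    intro n _
    have h1 : χ n ^ orderOf a = 1 := by rw [← map_pow, ha, map_one]
    obtain ⟨i, hi⟩ := Subgroup.mem_zpowers_iff.1
      (hζ.zpowers_eq.ge ((mem_rootsOfUnity _ _).2 h1))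
    refine Subgroup.mem_sup.2 ⟨n * (a ^ i)⁻¹, ?_, a ^ i, Subgroup.zpow_mem_zpowers _ _, by simp⟩
    rw [MonoidHom.mem_ker, map_mul, map_inv, map_zpow, hχa]
    exact mul_inv_eq_one.2 hi.symm

end Complement

/-! ### Decomposition into homocyclic factors -/

section Homocyclic

theorem exists_mulEquiv_pi_pow {A : Type*} [CommGroup A] [Finite A] {p t : ℕ} (hp : p.Prime)
    (h : ∀ l : A, l ^ p ^ t = 1) : ∃ (ι : Type) (_ : Fintype ι) (m : ι → ℕ),
      (∀ s, 0 < m s ∧ m s ≤ t) ∧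
      Nonempty (A ≃* ∀ s, Multiplicative (ZMod (p ^ m s))) := by
  classical
  obtain ⟨ι, _, n, hn, ⟨E⟩⟩ := CommGroup.equiv_prod_multiplicative_zmod_of_finite A
  have hdvd : ∀ s, n s ∣ p ^ t := by
    intro s
    have h1 : (Pi.mulSingle s (Multiplicative.ofAdd (1 : ZMod (n s))) :
        ∀ s, Multiplicative (ZMod (n s))) ^ p ^ t = 1 :=
      E.symm.injective (by rw [map_pow, h, map_one])
    have h2 := congrFun h1 s
    rw [Pi.pow_apply, Pi.mulSingle_eq_same, ← ofAdd_nsmul, nsmul_eq_mul, mul_one] at h2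
    exact (ZMod.natCast_eq_zero_iff _ _).1 h2
  choose m hm using fun s => (Nat.dvd_prime_pow hp).1 (hdvd s)
  obtain rfl : n = fun s => p ^ m s := funext fun s => (hm s).2
  refine ⟨ι, inferInstance, m, fun s => ⟨Nat.pos_of_ne_zero fun h0 => ?_, (hm s).1⟩, ⟨E⟩⟩
  have := hn s
  simp only [h0, pow_zero, lt_irrefl] at this

/-- A finite abelian group of exponent dividing `p ^ t` is a product of homocyclic groups. -/
theorem exists_mulEquiv_pi_homocyclic {A : Type*} [CommGroup A] [Finite A] {p t : ℕ}
    (hp : p.Prime) (ht : 1 ≤ t) (h : ∀ l : A, l ^ p ^ t = 1) :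
    ∃ (m : ℕ) (e : Fin (m + 1) → ℕ) (r : Fin (m + 1) → ℕ), (∀ i, 0 < e i) ∧ StrictMono e ∧
      e (Fin.last m) = t ∧ (∀ i : Fin m, 0 < r i.castSucc) ∧
      Nonempty (A ≃* ∀ i, Fin (r i) → Multiplicative (ZMod (p ^ e i))) := by
  classical
  obtain ⟨ι, _, n, hn, ⟨E⟩⟩ := exists_mulEquiv_pi_pow hp h
  -- Inserting `t` makes it the last exponent even when no cyclic factor has order `p ^ t`; the last
  -- rank is then `0`.
  let S : Finset ℕ := insert t (Finset.univ.image n)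
  have hS : ∀ x ∈ S, 0 < x ∧ x ≤ t := by
    intro x hx
    rcases Finset.mem_insert.1 hx with rfl | hx
    · exact ⟨ht, le_rfl⟩
    · obtain ⟨s, -, rfl⟩ := Finset.mem_image.1 hx
      exact hn s
  obtain ⟨m, hm⟩ := Nat.exists_eq_succ_of_ne_zero
    (Finset.card_pos.2 ⟨t, Finset.mem_insert_self t _⟩ : 0 < S.card).ne'
  let e : Fin (m + 1) ↪o ℕ := S.orderEmbOfFin hm
  have heS : ∀ i, e i ∈ S := fun i => Finset.orderEmbOfFin_mem S hm i
  have hex : ∀ x ∈ S, ∃ i, e i = x := by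
    intro x hx
    have : x ∈ Set.range (S.orderEmbOfFin hm) := by
      rw [Finset.range_orderEmbOfFin]
      exact hx
    exact this
  have hlast : e (Fin.last m) = t := by
    obtain ⟨i, hi⟩ := hex t (Finset.mem_insert_self t _)
    exact le_antisymm (hS _ (heS _)).2 (hi ▸ e.monotone (Fin.le_last i))
  choose κ hκ using fun s => hex (n s)
    (Finset.mem_insert_of_mem (Finset.mem_image_of_mem n (Finset.mem_univ s)))
  let r : Fin (m + 1) → ℕ := fun i => Nat.card {s // κ s = i}
  let σ : ι ≃ Σ i, Fin (r i) := (Equiv.sigmaFiberEquiv κ).symm.trans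
    (Equiv.sigmaCongrRight fun j => Finite.equivFin _)
  have hσ : ∀ q, n (σ.symm q) = e q.1 := by
    intro q
    obtain ⟨s, rfl⟩ := σ.surjective q
    rw [Equiv.symm_apply_apply, ← hκ s]
    rfl
  refine ⟨m, e, r, fun i => (hS _ (heS i)).1, e.strictMono, hlast, fun i => ?_, ?_⟩
  · have h1 : e i.castSucc ≠ t := by
      rw [← hlast]
      exact fun h' => (Fin.castSucc_lt_last i).ne (e.injective h')
    have h2 := (Finset.mem_insert.1 (heS i.castSucc)).resolve_left h1
    obtain ⟨s, -, hs⟩ := Finset.mem_image.1 h2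
    have : Nonempty {s // κ s = i.castSucc} := ⟨⟨s, e.injective ((hκ s).trans hs)⟩⟩
    exact Nat.card_pos
  · have E2 : ∀ n' : (Σ i, Fin (r i)) → ℕ, (∀ q, n (σ.symm q) = n' q) →
        Nonempty (A ≃* ∀ q, Multiplicative (ZMod (p ^ n' q))) := by
      intro n' hn'
      obtain rfl : (fun q => n (σ.symm q)) = n' := funext hn'
      exact ⟨E.trans
        { toEquiv := Equiv.piCongrLeft' (fun s => Multiplicative (ZMod (p ^ n s))) σ
          map_mul' := fun _ _ => rfl }⟩
    obtain ⟨E2⟩ := E2 (fun q => e q.1) hσ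
    exact ⟨E2.trans
      { toFun := fun f i j => f ⟨i, j⟩
        invFun := fun f s => f s.1 s.2
        left_inv := fun _ => rfl
        right_inv := fun _ => rfl
        map_mul' := fun _ _ => rfl }⟩

variable {ι : Type*} [Fintype ι] [DecidableEq ι] {X : ι → Type*} [∀ i, CommGroup (X i)]

theorem iSup_range_mulSingle : ⨆ i, (MonoidHom.mulSingle X i).range = ⊤ := by
  rw [eq_top_iff]
  intro f _
  rw [← Finset.univ_prod_mulSingle f]
  exact Subgroup.prod_mem _ fun i _ =>
    Subgroup.mem_iSup_of_mem (S := fun i => (MonoidHom.mulSingle X i).range) i ⟨f i, rfl⟩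

omit [Fintype ι] in
theorem iSupIndep_range_mulSingle : iSupIndep fun i => (MonoidHom.mulSingle X i).range := by
  intro i
  have h : ⨆ (j) (_ : j ≠ i), (MonoidHom.mulSingle X j).range ≤
      (Pi.evalMonoidHom X i).ker := by
    refine iSup₂_le fun j hj => ?_
    rintro _ ⟨x, rfl⟩
    exact Pi.mulSingle_eq_of_ne (Ne.symm hj) x
  refine Disjoint.mono_right h ?_
  rw [Subgroup.disjoint_def]
  rintro _ ⟨x, rfl⟩ hx
  have hx' : x = 1 := by
    have : (Pi.mulSingle i x : ∀ i, X i) i = 1 := hx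
    rwa [Pi.mulSingle_eq_same] at this
  rw [hx', map_one]

omit [Fintype ι] [DecidableEq ι] in
theorem iSupIndep_map {A B : Type*} [CommGroup A] [CommGroup B] {f : A →* B}
    (hf : Function.Injective f) {F : ι → Subgroup A} (h : iSupIndep F) :
    iSupIndep fun i => (F i).map f := by
  intro i
  have h1 : ⨆ (j) (_ : j ≠ i), (F j).map f = (⨆ (j) (_ : j ≠ i), F j).map f := by
    simp only [Subgroup.map_iSup]
  change Disjoint ((F i).map f) (⨆ (j) (_ : j ≠ i), (F j).map f)
  rw [h1, disjoint_iff, ← Subgroup.map_inf _ _ _ hf, disjoint_iff.1 (h i), Subgroup.map_bot]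

end Homocyclic

/-! ### Existence of the data -/

section Existence

variable {G : Type*} [CommGroup G] [Finite G] {p : ℕ} {b : G} {t : ℕ}

theorem nonempty_decomp (hp : p.Prime) (hG : IsPGroup p G) (hb : b ≠ 1) (ht : 1 ≤ t)
    (hbt : HasHeight p b t) : Nonempty (Decomp p b t) := by
  classical
  obtain ⟨a, ha⟩ := hbt.1
  have haN := mem_closure_nbhd_of_pow_eq hp hG hb ht ha
  have hao : orderOf a = p ^ t * orderOf b := orderOf_eq_pow_mul_of_pow_eq hp hG hb ha
  have hbm : Subgroup.zpowers b ≤ Subgroup.zpowers a := by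
    rw [Subgroup.zpowers_le, ← ha]
    exact Subgroup.npow_mem_zpowers _ _
  set N := Subgroup.closure (nbhd b) with hN
  -- `n ^ p ^ t` lies in `⟨b⟩`, so `n` is killed by `p ^ t · o(b) = o(a)`.
  obtain ⟨L₀, hL₀⟩ := exists_isCompl_zpowers (⟨a, haN⟩ : N) (by
    intro n
    obtain ⟨m, hm⟩ := Subgroup.mem_zpowers_iff.1
      (pow_mem_zpowers_of_mem_closure_nbhd hp hG hb hbt n.2)
    refine Subtype.ext ?_
    rw [← Subgroup.orderOf_coe, Subgroup.coe_pow, hao, pow_mul, ← hm, ← zpow_natCast, zpow_comm,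
      zpow_natCast, pow_orderOf_eq_one, one_zpow, Subgroup.coe_one])
  have hmap : (Subgroup.zpowers (⟨a, haN⟩ : N)).map N.subtype = Subgroup.zpowers a := by
    rw [MonoidHom.map_zpowers]
    rfl
  have hdisj : Disjoint (L₀.map N.subtype) (Subgroup.zpowers a) := by
    rw [← hmap, disjoint_iff, ← Subgroup.map_inf _ _ _ N.subtype_injective,
      disjoint_iff.1 hL₀.disjoint, Subgroup.map_bot]
  have hsup : L₀.map N.subtype ⊔ Subgroup.zpowers a = N := by
    rw [← hmap, ← Subgroup.map_sup, codisjoint_iff.1 hL₀.codisjoint, ← MonoidHom.range_eq_map,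
      Subgroup.range_subtype]
  generalize L₀.map N.subtype = L at hdisj hsup
  have hLpow : ∀ l : L, l ^ p ^ t = 1 := by
    intro l
    have h1 : (l : G) ∈ N := by
      rw [← hsup]
      exact (le_sup_left : L ≤ _) l.2
    have h2 := pow_mem_zpowers_of_mem_closure_nbhd hp hG hb hbt h1
    exact Subtype.ext (Subgroup.disjoint_def.1 hdisj (L.pow_mem l.2 _) (hbm h2))
  have hO : ∀ l : L, l ∈ Omega p (t + 1) L := fun l => by
    change l ^ p ^ (t + 1) = 1
    rw [pow_succ, pow_mul, hLpow, one_pow]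
  obtain ⟨m, e, r, he, hmono, hlast, hr, ⟨E⟩⟩ := exists_mulEquiv_pi_homocyclic hp ht hLpow
  let X : Fin (m + 1) → Type := fun i => Fin (r i) → Multiplicative (ZMod (p ^ e i))
  let f : (∀ i, X i) →* G := L.subtype.comp E.symm.toMonoidHom
  have hf : Function.Injective f := L.subtype_injective.comp E.symm.injective
  have hfr : f.range = L := by
    change (L.subtype.comp E.symm.toMonoidHom).range = L
    rw [MonoidHom.range_comp, MonoidHom.range_eq_top.2 E.symm.surjective, ← MonoidHom.range_eq_map,
      Subgroup.range_subtype]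
  let F : Fin (m + 1) → Subgroup G := fun i => ((MonoidHom.mulSingle X i).range).map f
  let E' : L ≃* ∀ s : (Σ i, Fin (r i)), Multiplicative (ZMod (p ^ e s.1)) := E.trans
    { toFun := fun f s => f s.1 s.2
      invFun := fun f i j => f ⟨i, j⟩
      left_inv := fun _ => rfl
      right_inv := fun _ => rfl
      map_mul' := fun _ _ => rfl }
  have hx : ∀ i : Fin m, Nonempty (HSet p (e i.castSucc) (Omega p (t + 1) L)) := by
    intro i
    obtain ⟨y, hy, hy'⟩ := exists_hasHeight_of_coordinate E' hp (fun s => he s.1)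
      (s := ⟨i.castSucc, ⟨0, hr i⟩⟩) (Nat.sub_add_cancel (he i.castSucc)).symm
    exact ⟨⟨⟨y, hO y⟩, (mem_hSet_omega_iff hO (he _)).2 ⟨hy, hy'⟩⟩⟩
  exact ⟨{
    a := a
    a_pow := ha
    L := L
    disjoint_L := hdisj
    sup_L := hsup
    m' := m
    F := F
    indep_F := iSupIndep_map hf iSupIndep_range_mulSingle
    iSup_F := by
      change ⨆ i, ((MonoidHom.mulSingle X i).range).map f = L
      rw [← Subgroup.map_iSup, iSup_range_mulSingle, ← MonoidHom.range_eq_map, hfr]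
    e := e
    e_pos := he
    e_strictMono := hmono
    e_last := hlast
    r := r
    r_pos := hr
    homocyclic := fun i => ⟨((MonoidHom.ofInjective (Pi.mulSingle_injective i)).trans
      (Subgroup.equivMapOfInjective (MonoidHom.mulSingle X i).range f hf)).symm⟩
    x := fun i => (hx i).some
    -- This is a `p`-th root of `b`, hence of order `p · o(b)`.
    c := a ^ p ^ (t - 1)
    c_mem := Subgroup.npow_mem_zpowers _ _
    orderOf_c := by
      rw [orderOf_eq_pow_mul_of_pow_eq hp hG hb (k := 1), pow_one]
      rw [pow_one, ← pow_mul, ← pow_succ, Nat.sub_add_cancel ht, ha] }⟩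

end Existence

end PowerGraphAut

theorem corollary4p7 {G : Type*} [CommGroup G] [Finite G] (p : ℕ) (hp : p.Prime)
    (hG : IsPGroup p G) (b : G) (hb : b ≠ 1) (t : ℕ) (ht : 1 ≤ t)
    (hbt : PowerGraphAut.HasHeight p b t) :
    Nonempty (PowerGraphAut.Decomp p b t) ∧
    ∀ D : PowerGraphAut.Decomp p b t,
      Nonempty (PowerGraphAut.AutHat b ≃*
        ((i : Fin D.m') → PowerGraphAut.WreathSym (PowerGraphAut.AutHat (D.pair i)) (D.k i)) ×
          PowerGraphAut.WreathSym (PowerGraphAut.AutHat D.c) (p ^ D.r (Fin.last D.m'))) :=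
  ⟨PowerGraphAut.nonempty_decomp hp hG hb ht hbt,
    fun D => D.nonempty_autHat_mulEquiv hp hG hb ht hbt⟩
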